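/- Let $M$ be a closed oriented surface with a conformal class $[g]$ of smooth Riemannian metrics, regarded as a Riemann surface with complex structure $J$ (rotation by $+\pi/2$), let $m\geqslant 2$ be an integer, and let $L_m=\Lambda^2(TM)^{(m-1)/2}\otimes\mathbb{C}$, where for an oriented real line bundle $\ell$ and $s\in\mathbb{R}$ the fibre of $\ell^s$ at a point consists of the real functions on the positive half-line of the fibre of $\ell^*$ that are homogeneous of degree $s$ (for $s\in\mathbb{N}$ this is the usual tensor power). A holomorphic line bundle structure on $L_m$ is given by its operator $\overline{\partial}_{L_m}:\Gamma(M,L_m)\to\Omega^{0,1}(M,L_m)$, an additive operator on smooth sections with $\overline{\partial}_{L_m}(f\sigma)=\overline{\partial}f\otimes\sigma+f\,\overline{\partial}_{L_m}\sigma$ for all $f\in C^\infty(M,\mathbb{C})$, such that $L_m$ has, near every point around which there is a holomorphic coordinate, a non-vanishing section $\sigma$ with $\overline{\partial}_{L_m}\sigma=0$. A $[g]$-conformal (Weyl) connection is a smooth torsion-free connection $\nabla$ on $TM$ such that $\nabla h=2\,\theta\otimes h$ for some $h\in[g]$ and some smooth $1$-form $\theta$. Then there is a canonical bijection between the set of holomorphic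 line bundle structures on $L_m$ and the set of $[g]$-conformal connections on $TM$: it matches $\overline{\partial}_{L_m}$ with the connection $\nabla$ such that $\overline{\partial}_{L_m}=\nabla^{(0,1)}$, where $\nabla$ on the right also denotes the complex-linear extension to $L_m$ of the connection that $\nabla$ induces on $\Lambda^2(TM)^{(m-1)/2}$. -/

import Mathlib

open scoped Manifold ContDiff Topology Bundle

noncomputable section

namespace WeylLine

/-- The model plane of a surface. -/
abbrev Plane : Type := EuclideanSpace ℝ (Fin 2)

section Basic

variable (M : Type*) [TopologicalSpace M] [ChartedSpace Plane M] [IsManifold (𝓡 2) ∞ M]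

/-- Smooth vector fields on the surface `M`. -/
abbrev VField : Type _ := Cₛ^∞⟮𝓡 2; Plane, (TangentSpace (𝓡 2) : M → Type)⟯

/-- Smooth complex-valued functions on the surface `M`. -/
abbrev CFun : Type _ := C^∞⟮𝓡 2, M; 𝓘(ℝ, ℂ), ℂ⟯

/-- Smooth Riemannian metrics on the surface `M`. -/
abbrev Metric : Type _ :=
  Bundle.ContMDiffRiemannianMetric (𝓡 2) ∞ Plane (TangentSpace (𝓡 2) : M → Type)

/-- A smooth endomorphism field `J` of `TM` with `J² = -1`.
On a surface with a metric `g`, a `g`-isometric such `J` is the same thing as an orientation: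
`J` is the rotation by the angle `+π/2`, and the positive bases are those of the
class of `(v, J v)`, `v ≠ 0`. -/
structure ComplexStr where
  toFun : ∀ x : M, TangentSpace (𝓡 2) x →L[ℝ] TangentSpace (𝓡 2) x
  sq : ∀ (x : M) (v : TangentSpace (𝓡 2) x), toFun x (toFun x v) = -v
  smooth : ∀ X : VField M, ContMDiff (𝓡 2) (𝓡 2).tangent ∞
    (fun x ↦ (⟨x, toFun x (X x)⟩ : TangentBundle (𝓡 2) M))

/-- Smooth real 1-forms. -/
structure OneForm where
  toFun : ∀ x : M, TangentSpace (𝓡 2) x →L[ℝ] ℝ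
  smooth : ∀ X : VField M, ContMDiff (𝓡 2) 𝓘(ℝ, ℝ) ∞ (fun x ↦ toFun x (X x))

end Basic

variable {M : Type*} [TopologicalSpace M] [ChartedSpace Plane M] [IsManifold (𝓡 2) ∞ M]

/-! ### Conformal connections -/

/-- `h = e^{2u} g` for some smooth function `u`, that is, `h ∈ [g]`. -/
def InConformalClass (g h : Metric M) : Prop :=
  ∃ u : C^∞⟮𝓡 2, M; 𝓘(ℝ, ℝ), ℝ⟯, ∀ (x : M) (v w : TangentSpace (𝓡 2) x),
    h.inner x v w = Real.exp (2 * u x) * g.inner x v w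

/-- `∇ h = 2 θ ⊗ h`. -/
def NablaMetricEq (D : CovariantDerivative (𝓡 2) Plane (TangentSpace (𝓡 2) : M → Type))
    (h : Metric M) (θ : OneForm M) : Prop :=
  ∀ (Y Z : VField M) (x : M) (v : TangentSpace (𝓡 2) x),
    mvfderiv (𝓡 2) (fun y ↦ h.inner y (Y y) (Z y)) x v
        - h.inner x (D Y x v) (Z x) - h.inner x (Y x) (D Z x v)
      = 2 * θ.toFun x v * h.inner x (Y x) (Z x)

/-- The `[g]`-conformal (Weyl) connections: smooth torsion-free connections `∇` on `TM` such that
`∇ h = 2 θ ⊗ h` for some `h ∈ [g]` and some smooth 1-form `θ`.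

Mathlib's `CovariantDerivative` is also evaluated, with arbitrary values, on vector fields which
are not differentiable at a point; `normalized` fixes these meaningless values, so that two
connections are equal as soon as they agree on differentiable vector fields. -/
structure ConformalConnection (g : Metric M) where
  conn : CovariantDerivative (𝓡 2) Plane (TangentSpace (𝓡 2) : M → Type)
  normalized : ∀ (Y : ∀ x : M, TangentSpace (𝓡 2) x) (x : M),
    ¬ MDifferentiableAt (𝓡 2) (𝓡 2).tangent
      (fun y ↦ (⟨y, Y y⟩ : TangentBundle (𝓡 2) M)) x → conn Y x = 0
  smooth : CovariantDerivative.ContMDiffCovariantDerivative conn ∞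
  torsion_free : conn.torsion = 0
  conformal : ∃ h : Metric M, InConformalClass g h ∧ ∃ θ : OneForm M, NablaMetricEq conn h θ

/-! ### The complex line bundle `Λ²(TM)^s ⊗ ℂ` -/

/-- The positive elements of `Λ²(T*_x M)`. -/
def PosForm (J : ComplexStr M) (x : M) : Type :=
  {η : TangentSpace (𝓡 2) x [⋀^Fin 2]→L[ℝ] ℝ //
    ∀ v : TangentSpace (𝓡 2) x, v ≠ 0 → 0 < η ![v, J.toFun x v]}

/-- The fibre at `x` of `Λ²(TM)^s ⊗ ℂ`, where `s` is a real number. For an oriented real line `ℓ`,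
the line `ℓ^s ⊗ ℂ` consists of the complex functions on the positive half of the dual line which
are homogeneous of degree `s`; the power `b^s` of a positive `b ∈ ℓ` is the function
`η ↦ (η b)^s`. Here `ℓ = Λ²(T_x M)`, with dual line `Λ²(T*_x M)`. -/
def Fibre (J : ComplexStr M) (s : ℝ) (x : M) : Submodule ℂ (PosForm J x → ℂ) where
  carrier := {φ | ∀ (η η' : PosForm J x) (c : ℝ), 0 < c → η'.1 = c • η.1 →
    φ η' = ((c ^ s : ℝ) : ℂ) * φ η}
  add_mem' {φ ψ} hφ hψ η η' c hc h := by
    simp only [Pi.add_apply]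
    rw [hφ η η' c hc h, hψ η η' c hc h, mul_add]
  zero_mem' η η' c _ _ := by simp
  smul_mem' a φ hφ η η' c hc h := by
    simp only [Pi.smul_apply, smul_eq_mul]
    rw [hφ η η' c hc h, mul_left_comm]

/-- Smooth positive area forms on `M`. -/
structure AreaForm (J : ComplexStr M) where
  toFun : ∀ x : M, PosForm J x
  smooth : ∀ X Y : VField M, ContMDiff (𝓡 2) 𝓘(ℝ, ℝ) ∞ (fun x ↦ (toFun x).1 ![X x, Y x])

/-- Smooth sections of `Λ²(TM)^s ⊗ ℂ`. -/
@[ext]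
structure LSection (J : ComplexStr M) (s : ℝ) where
  toFun : ∀ x : M, Fibre J s x
  smooth : ∀ η : AreaForm J,
    ContMDiff (𝓡 2) 𝓘(ℝ, ℂ) ∞ (fun x ↦ (toFun x).1 (η.toFun x))

instance (J : ComplexStr M) (s : ℝ) : Add (LSection J s) where
  add σ τ := ⟨fun x ↦ σ.toFun x + τ.toFun x, fun η ↦ (σ.smooth η).add (τ.smooth η)⟩

instance (J : ComplexStr M) (s : ℝ) : SMul (CFun M) (LSection J s) where
  smul f σ := ⟨fun x ↦ f x • σ.toFun x, fun η ↦
    (contDiff_mul (𝕜 := ℝ) (𝔸 := ℂ)).contMDiff.comp (f.contMDiff.prodMk_space (σ.smooth η))⟩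

/-- Smooth `(0,1)`-forms on `M` with values in `Λ²(TM)^s ⊗ ℂ`. -/
@[ext]
structure LForm01 (J : ComplexStr M) (s : ℝ) where
  toFun : ∀ x : M, TangentSpace (𝓡 2) x →ₗ[ℝ] Fibre J s x
  type01 : ∀ (x : M) (v : TangentSpace (𝓡 2) x),
    toFun x (J.toFun x v) = -(Complex.I • toFun x v)
  smooth : ∀ (X : VField M) (η : AreaForm J),
    ContMDiff (𝓡 2) 𝓘(ℝ, ℂ) ∞ (fun x ↦ (toFun x (X x)).1 (η.toFun x))

/-! ### Holomorphic line bundle structures -/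

/-- `∂̄f (v) = (df(v) + i df(Jv)) / 2`. -/
def dbarFun (J : ComplexStr M) (f : M → ℂ) (x : M) (v : TangentSpace (𝓡 2) x) : ℂ :=
  (1 / 2 : ℂ) * (mvfderiv (𝓡 2) f x v + Complex.I * mvfderiv (𝓡 2) f x (J.toFun x v))

/-- `z` is a local holomorphic coordinate of the Riemann surface `(M, J)` around `x`. -/
def IsHolCoordAt (J : ComplexStr M) (z : M → ℂ) (x : M) : Prop :=
  (∀ᶠ y in 𝓝 x, ContMDiffAt (𝓡 2) 𝓘(ℝ, ℂ) ∞ z y ∧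
    ∀ v : TangentSpace (𝓡 2) y, dbarFun J z y v = 0) ∧
  mvfderiv (𝓡 2) z x ≠ 0

/-- Holomorphic line bundle structures on the smooth complex line bundle `Λ²(TM)^s ⊗ ℂ` over the
Riemann surface `(M, J)`, given by their operators `∂̄ : Γ(L) → Ω^{0,1}(L)`. By `frame`, in every
local holomorphic coordinate the bundle is locally trivialized by sections `σ` with `∂̄ σ = 0`,
and by the Leibniz rule the transition functions between such sections are holomorphic. (There
is no further integrability condition, as `M` carries no nonzero `(0,2)`-forms.) -/
@[ext]
structure HolStructure (J : ComplexStr M) (s : ℝ) where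
  dbar : LSection J s → LForm01 J s
  add : ∀ (σ τ : LSection J s) (x : M),
    (dbar (σ + τ)).toFun x = (dbar σ).toFun x + (dbar τ).toFun x
  leibniz : ∀ (f : CFun M) (σ : LSection J s) (x : M) (v : TangentSpace (𝓡 2) x),
    (dbar (f • σ)).toFun x v = f x • (dbar σ).toFun x v + dbarFun J f x v • σ.toFun x
  frame : ∀ (x : M) (z : M → ℂ), IsHolCoordAt J z x →
    ∃ σ : LSection J s, σ.toFun x ≠ 0 ∧ ∀ᶠ y in 𝓝 x, (dbar σ).toFun y = 0

/-! ### The `(0,1)`-part of the connection induced on the line bundle -/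

/-- `(∇_v η)(X, Y)` at the point `x`, for a 2-form `η` and vector fields `X`, `Y`. -/
def nablaForm {J : ComplexStr M}
    (D : CovariantDerivative (𝓡 2) Plane (TangentSpace (𝓡 2) : M → Type))
    (η : AreaForm J) (X Y : VField M) (x : M) (v : TangentSpace (𝓡 2) x) : ℝ :=
  mvfderiv (𝓡 2) (fun y ↦ (η.toFun y).1 ![X y, Y y]) x v
    - (η.toFun x).1 ![D X x v, Y x] - (η.toFun x).1 ![X x, D Y x v]

/-- `DL` is the connection induced by `D` on `L = Λ²(TM)^s ⊗ ℂ` (extended complex linearly):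
if `∇_v η = β(v) η`, then `(∇_v σ)(η) = d(σ(η))(v) - s β(v) σ(η)`. (For `σ = b^s`, `σ(η) = η(b)^s`,
this says `∇_v (b^s) = s b^{s-1} ∇_v b`.) The identity is multiplied by `η(X, Y)`, for
arbitrary vector fields `X`, `Y`. -/
def IsInducedConnection {J : ComplexStr M} {s : ℝ}
    (D : CovariantDerivative (𝓡 2) Plane (TangentSpace (𝓡 2) : M → Type))
    (DL : LSection J s → ∀ x : M, TangentSpace (𝓡 2) x →ₗ[ℝ] Fibre J s x) : Prop :=
  ∀ (σ : LSection J s) (η : AreaForm J) (X Y : VField M) (x : M) (v : TangentSpace (𝓡 2) x),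
    (((η.toFun x).1 ![X x, Y x] : ℝ) : ℂ) * (DL σ x v).1 (η.toFun x)
      = (((η.toFun x).1 ![X x, Y x] : ℝ) : ℂ)
          * mvfderiv (𝓡 2) (fun y ↦ (σ.toFun y).1 (η.toFun y)) x v
        - (s : ℂ) * ((nablaForm D η X Y x v : ℝ) : ℂ) * (σ.toFun x).1 (η.toFun x)

/-- `∂̄_L = ∇^{(0,1)}`, where `∇` also denotes the connection induced on `L`. -/
def IsZeroOnePart {J : ComplexStr M} {s : ℝ}
    (D : CovariantDerivative (𝓡 2) Plane (TangentSpace (𝓡 2) : M → Type))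
    (H : HolStructure J s) : Prop :=
  ∃ DL : LSection J s → ∀ x : M, TangentSpace (𝓡 2) x →ₗ[ℝ] Fibre J s x,
    IsInducedConnection D DL ∧
    ∀ (σ : LSection J s) (x : M) (v : TangentSpace (𝓡 2) x),
      (H.dbar σ).toFun x v
        = (1 / 2 : ℂ) • (DL σ x v + Complex.I • DL σ x (J.toFun x v))

end WeylLine

end

open WeylLine

noncomputable section

namespace WeylLine

open Bundle

/-! ### The `∂̄`-equation in the plane -/

section Plane
open MeasureTheory Set

theorem locallyIntegrable_inv_complex : LocallyIntegrable (fun w : ℂ ↦ w⁻¹) volume := by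
  refine locallyIntegrable_of_norm_le_rpow (C := 1) (α := 1) ?_ ?_ ?_ ?_
  · simp
  · simp
  · filter_upwards with w
    rw [norm_inv, Real.rpow_neg_one, one_mul]
  · exact measurable_inv.aestronglyMeasurable

/-- The point `z - r e^{iθ}`, with `p = (r, θ)`. -/
def polarPoint (z : ℂ) (p : ℝ × ℝ) : ℂ := z - p.1 * Complex.exp (p.2 * Complex.I)

theorem continuous_polarPoint (z : ℂ) : Continuous (polarPoint z) := by
  unfold polarPoint; fun_prop

/-- Supplies, uniformly in the angle, a radius beyond which the point has left the support of `b`.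
-/
theorem norm_polarPoint_ge (z : ℂ) {p : ℝ × ℝ} (hp : 0 ≤ p.1) : p.1 - ‖z‖ ≤ ‖polarPoint z p‖ := by
  have h : ‖(p.1 : ℂ) * Complex.exp (p.2 * Complex.I)‖ = p.1 := by
    rw [norm_mul, Complex.norm_exp_ofReal_mul_I, mul_one, Complex.norm_real, Real.norm_of_nonneg hp]
  have := norm_sub_norm_le ((p.1 : ℂ) * Complex.exp (p.2 * Complex.I)) z
  rw [h, norm_sub_rev] at this
  exact this

variable {b : ℂ → ℂ} (hb : ContDiff ℝ 1 b) (hc : HasCompactSupport b)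

include hb in
theorem hasDerivAt_polarPoint_radius (z : ℂ) (r θ : ℝ) :
    HasDerivAt (fun r : ℝ ↦ -b (polarPoint z (r, θ)))
      (fderiv ℝ b (polarPoint z (r, θ)) (Complex.exp (θ * Complex.I))) r := by
  have h1 : HasDerivAt (fun r : ℝ ↦ polarPoint z (r, θ)) (-Complex.exp (θ * Complex.I)) r := by
    have := (((Complex.ofRealCLM.hasDerivAt (x := r)).mul_const
      (Complex.exp (θ * Complex.I)))).const_sub z
    simpa [polarPoint] using this
  have h2 := ((hb.differentiable one_ne_zero (polarPoint z (r, θ))).hasFDerivAt.comp_hasDerivAt r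
    h1).neg
  exact h2.congr_deriv (by rw [map_neg, neg_neg])

include hb in
theorem hasDerivAt_polarPoint_angle (z : ℂ) (r θ : ℝ) :
    HasDerivAt (fun θ : ℝ ↦ -b (polarPoint z (r, θ)))
      (r * fderiv ℝ b (polarPoint z (r, θ)) (Complex.I * Complex.exp (θ * Complex.I))) θ := by
  have h0 : HasDerivAt (fun θ : ℝ ↦ Complex.exp (θ * Complex.I))
      (Complex.I * Complex.exp (θ * Complex.I)) θ := by
    have := ((Complex.ofRealCLM.hasDerivAt (x := θ)).mul_const Complex.I).cexp
    simpa [mul_comm] using this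
  have h1 : HasDerivAt (fun θ : ℝ ↦ polarPoint z (r, θ))
      (-(r • (Complex.I * Complex.exp (θ * Complex.I)))) θ := by
    have := (h0.const_mul (r : ℂ)).const_sub z
    simpa [polarPoint] using this
  have h2 := ((hb.differentiable one_ne_zero (polarPoint z (r, θ))).hasFDerivAt.comp_hasDerivAt θ
    h1).neg
  exact h2.congr_deriv (by rw [map_neg, neg_neg, map_smul, Complex.real_smul])

include hb hc in
-- In polar coordinates the Jacobian `r` absorbs the singularity of `1 / w`, so the integrands to be
-- treated are continuous and vanish for large `r`.
theorem integrableOn_polar (z : ℂ) {v : ℝ → ℂ} (hv : Continuous v) :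
    IntegrableOn (fun p : ℝ × ℝ ↦ fderiv ℝ b (polarPoint z p) (v p.2))
      (Ioi 0 ×ˢ Ioo (-Real.pi) Real.pi) := by
  obtain ⟨R, -, hR⟩ := (hc.fderiv ℝ).exists_pos_le_norm
  have hcont : Continuous (fun p : ℝ × ℝ ↦ fderiv ℝ b (polarPoint z p) (v p.2)) :=
    ((hb.continuous_fderiv one_ne_zero).comp (continuous_polarPoint z)).clm_apply
      (hv.comp continuous_snd)
  have h1 : IntegrableOn (fun p : ℝ × ℝ ↦ fderiv ℝ b (polarPoint z p) (v p.2))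
      (Icc 0 (R + ‖z‖) ×ˢ Icc (-Real.pi) Real.pi) :=
    hcont.continuousOn.integrableOn_compact (isCompact_Icc.prod isCompact_Icc)
  refine h1.of_forall_sdiff_eq_zero (measurableSet_Ioi.prod measurableSet_Ioo) ?_
  rintro p ⟨⟨hp1, hp2⟩, hp3⟩
  have hp1 : 0 < p.1 := hp1
  have : R + ‖z‖ < p.1 := by
    by_contra hle
    exact hp3 ⟨⟨hp1.le, not_lt.1 hle⟩, ⟨hp2.1.le, hp2.2.le⟩⟩
  rw [hR _ (by linarith [norm_polarPoint_ge z hp1.le])]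
  rfl

include hb hc in
-- The integrand is the `r`-derivative of `-b` along a ray issuing from `z`, and `b` vanishes far
-- out; only the endpoint `r = 0` contributes.
theorem integral_radius (z : ℂ) (θ : ℝ) :
    ∫ r in Ioi (0 : ℝ), fderiv ℝ b (polarPoint z (r, θ)) (Complex.exp (θ * Complex.I)) = b z := by
  obtain ⟨R, -, hR⟩ := (hc.fderiv ℝ).exists_pos_le_norm
  obtain ⟨R', -, hR'⟩ := hc.exists_pos_le_norm
  have hcont : Continuous
      (fun r : ℝ ↦ fderiv ℝ b (polarPoint z (r, θ)) (Complex.exp (θ * Complex.I))) :=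
    ((hb.continuous_fderiv one_ne_zero).comp ((continuous_polarPoint z).comp
      (Continuous.prodMk_left θ))).clm_apply continuous_const
  have hint : IntegrableOn
      (fun r : ℝ ↦ fderiv ℝ b (polarPoint z (r, θ)) (Complex.exp (θ * Complex.I))) (Ioi 0) := by
    refine (hcont.continuousOn.integrableOn_compact
      (isCompact_Icc (a := 0) (b := R + ‖z‖))).of_forall_sdiff_eq_zero measurableSet_Ioi ?_
    rintro r ⟨hr1, hr2⟩
    have hr1 : 0 < r := hr1
    have : R + ‖z‖ < r := by
      by_contra hle
      exact hr2 ⟨hr1.le, not_lt.1 hle⟩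
    rw [hR _ (by linarith [norm_polarPoint_ge z (p := (r, θ)) hr1.le])]
    rfl
  have hlim : Filter.Tendsto (fun r : ℝ ↦ -b (polarPoint z (r, θ))) Filter.atTop (𝓝 0) := by
    refine tendsto_const_nhds.congr' ?_
    filter_upwards [Filter.eventually_ge_atTop (max 0 (R' + ‖z‖))] with r hr
    rw [hR' _ (by linarith [norm_polarPoint_ge z (p := (r, θ)) ((le_max_left _ _).trans hr),
      (le_max_right 0 (R' + ‖z‖)).trans hr]), neg_zero]
  have := integral_Ioi_of_hasDerivAt_of_tendsto'
    (fun r _ ↦ hasDerivAt_polarPoint_radius hb z r θ) hint hlim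
  rw [this]
  simp [polarPoint]

include hb in
-- Up to the factor `r`, the integrand is the angular derivative of `-b` on a closed circle.
theorem integral_angle (z : ℂ) {r : ℝ} (hr : 0 < r) :
    ∫ θ in Ioo (-Real.pi) Real.pi, fderiv ℝ b (polarPoint z (r, θ))
      (Complex.I * Complex.exp (θ * Complex.I)) = 0 := by
  have hcont : Continuous (fun θ : ℝ ↦ (r : ℂ) * fderiv ℝ b (polarPoint z (r, θ))
      (Complex.I * Complex.exp (θ * Complex.I))) :=
    continuous_const.mul (((hb.continuous_fderiv one_ne_zero).comp ((continuous_polarPoint z).comp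
      (Continuous.prodMk_right r))).clm_apply (by fun_prop))
  have h1 := intervalIntegral.integral_eq_sub_of_hasDerivAt (a := -Real.pi) (b := Real.pi)
    (fun θ _ ↦ hasDerivAt_polarPoint_angle hb z r θ) (hcont.intervalIntegrable _ _)
  rw [intervalIntegral.integral_of_le (by linarith [Real.pi_pos]), integral_Ioc_eq_integral_Ioo,
    integral_const_mul] at h1
  have h2 : polarPoint z (r, Real.pi) = polarPoint z (r, -Real.pi) := by
    simp [polarPoint, Complex.exp_neg, Complex.exp_pi_mul_I]
  rw [h2, sub_self] at h1
  exact (mul_eq_zero.1 h1).resolve_left (by exact_mod_cast hr.ne')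

/-- The map `e ↦ L e + i L (i e)` is conjugate linear. This expresses `∂̄` in the rotated frame
`e^{iθ}, i e^{iθ}`, and later gives the factor `conj (dz)` in the chain rule. -/
theorem conj_mul_apply_add (L : ℂ →L[ℝ] ℂ) (e : ℂ) :
    (starRingEnd ℂ) e * (L 1 + Complex.I * L Complex.I) = L e + Complex.I * L (Complex.I * e) := by
  have h1 : e = e.re • (1 : ℂ) + e.im • Complex.I := by simp
  have h2 : Complex.I * e = -e.im • (1 : ℂ) + e.re • Complex.I := by
    apply Complex.ext <;> simp
  have h3 : (starRingEnd ℂ) e = (e.re : ℂ) - e.im * Complex.I := by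
    apply Complex.ext <;> simp
  have hLe : L e = e.re * L 1 + e.im * L Complex.I := by
    conv_lhs => rw [h1]
    rw [map_add, map_smul, map_smul, Complex.real_smul, Complex.real_smul]
  rw [h3, h2, hLe, map_add, map_smul, map_smul, Complex.real_smul, Complex.real_smul]
  push_cast
  linear_combination (-e.im * L Complex.I) * Complex.I_mul_I

include hb hc in
/-- The Cauchy-Pompeiu formula for functions of compact support. -/
theorem integral_inv_mul_dbar (z : ℂ) :
    ∫ w : ℂ, w⁻¹ * (fderiv ℝ b (z - w) 1 + Complex.I * fderiv ℝ b (z - w) Complex.I) =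
      2 * Real.pi * b z := by
  rw [← Complex.integral_comp_polarCoord_symm]
  have hF := integrableOn_polar hb hc z (v := fun θ ↦ Complex.exp (θ * Complex.I)) (by fun_prop)
  have hG := integrableOn_polar hb hc z
    (v := fun θ ↦ Complex.I * Complex.exp (θ * Complex.I)) (by fun_prop)
  -- With `w = r e^{iθ}`, the product `r w⁻¹` is `e^{-iθ} = conj (e^{iθ})`, which turns the fixed
  -- frame `1, i` into the radial and angular directions.
  have hcongr : ∀ p ∈ polarCoord.target,
      p.1 • ((Complex.polarCoord.symm p)⁻¹ * (fderiv ℝ b (z - Complex.polarCoord.symm p) 1 +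
        Complex.I * fderiv ℝ b (z - Complex.polarCoord.symm p) Complex.I)) =
      fderiv ℝ b (polarPoint z p) (Complex.exp (p.2 * Complex.I)) + Complex.I *
        fderiv ℝ b (polarPoint z p) (Complex.I * Complex.exp (p.2 * Complex.I)) := by
    intro p hp
    have hp1 : (0 : ℝ) < p.1 := hp.1
    have hsymm : Complex.polarCoord.symm p = p.1 * Complex.exp (p.2 * Complex.I) := by
      rw [Complex.polarCoord_symm_apply, Complex.exp_mul_I]
      push_cast; rfl
    rw [← conj_mul_apply_add, ← Complex.inv_eq_conj (Complex.norm_exp_ofReal_mul_I p.2), hsymm, polarPoint, mul_inv,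
      Complex.real_smul]
    have : (p.1 : ℂ) ≠ 0 := by exact_mod_cast hp1.ne'
    field_simp
  rw [setIntegral_congr_fun polarCoord.open_target.measurableSet hcongr]
  change ∫ p in Ioi (0 : ℝ) ×ˢ Ioo (-Real.pi) Real.pi, _ = _
  rw [integral_add hF (hG.const_mul _), integral_const_mul]
  have h2 : ∫ p in Ioi (0 : ℝ) ×ˢ Ioo (-Real.pi) Real.pi,
      fderiv ℝ b (polarPoint z p) (Complex.I * Complex.exp (p.2 * Complex.I)) = 0 := by
    rw [Measure.volume_eq_prod, setIntegral_prod _ hG]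
    refine (setIntegral_congr_fun measurableSet_Ioi fun r hr ↦ integral_angle hb z hr).trans ?_
    simp
  have h1 : ∫ p in Ioi (0 : ℝ) ×ˢ Ioo (-Real.pi) Real.pi,
      fderiv ℝ b (polarPoint z p) (Complex.exp (p.2 * Complex.I)) = 2 * Real.pi * b z := by
    rw [Measure.volume_eq_prod, setIntegral_prod _ hF, integral_integral_swap]
    · simp only [integral_radius hb hc z]
      rw [setIntegral_const, Real.volume_real_Ioo_of_le (by linarith [Real.pi_pos]),
        Complex.real_smul]
      push_cast
      ring
    · rw [Measure.prod_restrict]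
      exact hF
  rw [h1, h2]
  ring

/-- The `∂̄`-equation with smooth right-hand side of compact support has a smooth solution. -/
theorem exists_dbar_eq {b : ℂ → ℂ} (hb : ContDiff ℝ ∞ b) (hc : HasCompactSupport b) :
    ∃ U : ℂ → ℂ, ContDiff ℝ ∞ U ∧ ∀ z,
      (1 / 2 : ℂ) * (fderiv ℝ U z 1 + Complex.I * fderiv ℝ U z Complex.I) = b z := by
  have hb1 : ContDiff ℝ 1 b := hb.of_le (by simp)
  set K : ℂ → ℂ := fun w ↦ w⁻¹ with hKdef
  have hK : LocallyIntegrable K volume := locallyIntegrable_inv_complex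
  set U₀ : ℂ → ℂ := convolution K b (ContinuousLinearMap.mul ℝ ℂ) volume with hU₀
  have hU : ContDiff ℝ ∞ U₀ := hc.contDiff_convolution_right _ hK hb
  have hd (z v : ℂ) : fderiv ℝ U₀ z v = ∫ w, w⁻¹ * fderiv ℝ b (z - w) v := by
    rw [(hc.hasFDerivAt_convolution_right (ContinuousLinearMap.mul ℝ ℂ) hK hb1 z).fderiv,
      convolution_precompR_apply _ hK (hc.fderiv ℝ) (hb1.continuous_fderiv one_ne_zero)]
    rfl
  have hint (z v : ℂ) : Integrable (fun w ↦ w⁻¹ * fderiv ℝ b (z - w) v) := by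
    have hcv : HasCompactSupport (fun w ↦ fderiv ℝ b w v) := (hc.fderiv ℝ).comp_left (g := fun L : ℂ →L[ℝ] ℂ ↦ L v) rfl
    exact hcv.convolutionExists_right (ContinuousLinearMap.mul ℝ ℂ) hK
      ((hb1.continuous_fderiv one_ne_zero).clm_apply continuous_const) z
  -- The constant `2π` of Cauchy-Pompeiu times the `1/2` in `∂̄` leaves `π`.
  refine ⟨fun z ↦ (Real.pi : ℂ)⁻¹ * U₀ z, contDiff_const.mul hU, fun z ↦ ?_⟩
  have hπ : (Real.pi : ℂ) ≠ 0 := by exact_mod_cast Real.pi_ne_zero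
  have hdU := hU.differentiable (by simp) z
  have : fderiv ℝ (fun z ↦ (Real.pi : ℂ)⁻¹ * U₀ z) z = (Real.pi : ℂ)⁻¹ • fderiv ℝ U₀ z :=
    fderiv_const_mul hdU _
  have key := integral_inv_mul_dbar hb1 hc z
  have hsplit : ∫ w : ℂ, w⁻¹ * (fderiv ℝ b (z - w) 1 + Complex.I * fderiv ℝ b (z - w) Complex.I) =
      fderiv ℝ U₀ z 1 + Complex.I * fderiv ℝ U₀ z Complex.I := by
    rw [hd, hd, ← integral_const_mul, ← integral_add (hint z 1) ((hint z Complex.I).const_mul _)]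
    congr 1
    funext w
    ring
  rw [this]
  simp only [smul_apply, smul_eq_mul]
  rw [hsplit] at key
  field_simp
  linear_combination key

end Plane

variable {M : Type*} [TopologicalSpace M] [ChartedSpace Plane M] [IsManifold (𝓡 2) ∞ M]

section Smooth

/-! ### Extending germs of smooth functions and vector fields -/

/-- The support condition lets `ψ` times an object that is smooth only near `x` be smooth on all of
`M` without changing the germ at `x`. Sections and vector fields here are global, so local
constructions pass through this. -/
theorem exists_bump_of_eventually [T2Space M] {x : M} {p : M → Prop} (hp : ∀ᶠ y in 𝓝 x, p y) :
    ∃ (ψ : M → ℝ) (u : Set M), IsOpen u ∧ ContMDiff (𝓡 2) 𝓘(ℝ, ℝ) ∞ ψ ∧ tsupport ψ ⊆ u ∧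
      (∀ y ∈ u, p y) ∧ ∀ᶠ y in 𝓝 x, ψ y = 1 := by
  obtain ⟨u, hu, hopen, hx⟩ := eventually_nhds_iff.1 hp
  obtain ⟨ψ, hψ, -⟩ :=
    (SmoothBumpFunction.nhds_basis_support (I := 𝓡 2) (hopen.mem_nhds hx)).mem_iff.1
      (Filter.univ_mem : Set.univ ∈ 𝓝 x)
  exact ⟨ψ, u, hopen, ψ.contMDiff, hψ, hu, ψ.eventuallyEq_one⟩

theorem exists_contMDiffMap_eventuallyEq [T2Space M] {F : Type*} [NormedAddCommGroup F]
    [NormedSpace ℝ F] {f : M → F} {x : M}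
    (hf : ∀ᶠ y in 𝓝 x, ContMDiffAt (𝓡 2) 𝓘(ℝ, F) ∞ f y) :
    ∃ f' : C^∞⟮𝓡 2, M; 𝓘(ℝ, F), F⟯, ∀ᶠ y in 𝓝 x, f' y = f y := by
  obtain ⟨ψ, u, -, hψ, hsupp, hu, h1⟩ := exists_bump_of_eventually hf
  refine ⟨⟨fun y ↦ ψ y • f y, contMDiff_of_tsupport fun y hy ↦ ?_⟩, ?_⟩
  · exact hψ.contMDiffAt.smul (hu y (hsupp (tsupport_smul_subset_left _ _ hy)))
  · filter_upwards [h1] with y hy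
    change ψ y • f y = f y
    rw [hy, one_smul]

theorem exists_vField_eventuallyEq [T2Space M] {s : ∀ x : M, TangentSpace (𝓡 2) x} {x : M}
    (hs : ∀ᶠ y in 𝓝 x, ContMDiffAt (𝓡 2) (𝓡 2).tangent ∞
      (fun y ↦ (⟨y, s y⟩ : TangentBundle (𝓡 2) M)) y) :
    ∃ X : VField M, ∀ᶠ y in 𝓝 x, X y = s y := by
  obtain ⟨ψ, u, hopen, hψ, hsupp, hu, h1⟩ := exists_bump_of_eventually hs
  refine ⟨⟨ψ • s, ?_⟩, ?_⟩
  · exact ContMDiffOn.smul_section_of_tsupport hψ.contMDiffOn hopen hsupp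
      fun y hy ↦ (hu y hy).contMDiffWithinAt
  · filter_upwards [h1] with y hy
    change ψ y • s y = s y
    rw [hy, one_smul]

theorem exists_vField_eventuallyEq_extend [T2Space M] {x : M} (v : TangentSpace (𝓡 2) x) :
    ∃ X : VField M, ∀ᶠ y in 𝓝 x, X y = FiberBundle.extend Plane v y := by
  obtain ⟨s, hs, h⟩ := FiberBundle.exists_contMDiffOn_extend (k := ∞) (𝓡 2) Plane v
  refine exists_vField_eventuallyEq ?_
  filter_upwards [eventually_mem_nhds_iff.2 hs] with y hy
  exact h.contMDiffAt hy

theorem exists_vField_apply_eq [T2Space M] {x : M} (v : TangentSpace (𝓡 2) x) :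
    ∃ X : VField M, X x = v := by
  obtain ⟨X, hX⟩ := exists_vField_eventuallyEq_extend v
  exact ⟨X, by simpa using hX.self_of_nhds⟩

theorem mdifferentiableAt_vField (X : VField M) (x : M) :
    MDifferentiableAt (𝓡 2) (𝓡 2).tangent (fun y ↦ (⟨y, X y⟩ : TangentBundle (𝓡 2) M)) x :=
  X.contMDiff.mdifferentiable (by simp) x

/-! ### Smoothness of contractions -/

/-- The vector field `J X`. -/
def ComplexStr.mapField (J : ComplexStr M) (X : VField M) : VField M :=
  ⟨fun x ↦ J.toFun x (X x), J.smooth X⟩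

@[simp] theorem ComplexStr.mapField_apply (J : ComplexStr M) (X : VField M) (x : M) :
    J.mapField X x = J.toFun x (X x) := rfl

theorem Metric.contMDiffAt_inner (g : Metric M) {X Y : ∀ x : M, TangentSpace (𝓡 2) x} {x : M}
    {n : ℕ∞ω} (hn : n ≤ ∞)
    (hX : ContMDiffAt (𝓡 2) (𝓡 2).tangent n (fun y ↦ (⟨y, X y⟩ : TangentBundle (𝓡 2) M)) x)
    (hY : ContMDiffAt (𝓡 2) (𝓡 2).tangent n (fun y ↦ (⟨y, Y y⟩ : TangentBundle (𝓡 2) M)) x) :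
    ContMDiffAt (𝓡 2) 𝓘(ℝ, ℝ) n (fun y ↦ g.inner y (X y) (Y y)) x := by
  have : ContMDiffAt (𝓡 2) ((𝓡 2).prod 𝓘(ℝ, ℝ)) n
      (fun m ↦ TotalSpace.mk' ℝ (E := Bundle.Trivial M ℝ) m (g.inner m (X m) (Y m))) x :=
    ContMDiffAt.clm_bundle_apply₂ (F₁ := Plane) (F₂ := Plane)
      ((g.contMDiff.of_le hn).contMDiffAt) hX hY
  simp only [contMDiffAt_totalSpace] at this
  exact this.2

theorem Metric.contMDiff_inner (g : Metric M) (X Y : VField M) :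
    ContMDiff (𝓡 2) 𝓘(ℝ, ℝ) ∞ (fun y ↦ g.inner y (X y) (Y y)) := fun _ ↦
  g.contMDiffAt_inner le_rfl X.contMDiff.contMDiffAt Y.contMDiff.contMDiffAt

theorem Metric.mdifferentiableAt_inner (g : Metric M) {X Y : ∀ x : M, TangentSpace (𝓡 2) x} {x : M}
    (hX : MDifferentiableAt (𝓡 2) (𝓡 2).tangent (fun y ↦ (⟨y, X y⟩ : TangentBundle (𝓡 2) M)) x)
    (hY : MDifferentiableAt (𝓡 2) (𝓡 2).tangent (fun y ↦ (⟨y, Y y⟩ : TangentBundle (𝓡 2) M)) x) :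
    MDifferentiableAt (𝓡 2) 𝓘(ℝ, ℝ) (fun y ↦ g.inner y (X y) (Y y)) x := by
  have : MDifferentiableAt (𝓡 2) ((𝓡 2).prod 𝓘(ℝ, ℝ))
      (fun m ↦ TotalSpace.mk' ℝ (E := Bundle.Trivial M ℝ) m (g.inner m (X m) (Y m))) x :=
    MDifferentiableAt.clm_bundle_apply₂ (F₁ := Plane) (F₂ := Plane)
      (g.contMDiff.mdifferentiable (by simp) x) hX hY
  simp only [mdifferentiableAt_totalSpace] at this
  exact this.2

theorem contMDiff_mvfderiv_apply {F : Type*} [NormedAddCommGroup F] [NormedSpace ℝ F] {f : M → F}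
    (hf : ContMDiff (𝓡 2) 𝓘(ℝ, F) ∞ f) (X : VField M) :
    ContMDiff (𝓡 2) 𝓘(ℝ, F) ∞ (fun x ↦ mvfderiv (𝓡 2) f x (X x)) := by
  have h1 : ContMDiff (𝓡 2) 𝓘(ℝ, F).tangent ∞
      (fun x ↦ tangentMap (𝓡 2) 𝓘(ℝ, F) f ⟨x, X x⟩) :=
    (hf.contMDiff_tangentMap (m := ∞) (by simp)).comp X.contMDiff
  exact (contMDiff_snd_tangentBundle_modelSpace F 𝓘(ℝ, F)).comp h1

theorem contMDiff_mlieBracket (X Y : VField M) :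
    ContMDiff (𝓡 2) (𝓡 2).tangent ∞
      (fun x ↦ (⟨x, VectorField.mlieBracket (𝓡 2) X Y x⟩ : TangentBundle (𝓡 2) M)) := fun x ↦ by
  have : IsManifold (𝓡 2) (minSmoothness ℝ 2) M := by
    rw [minSmoothness_of_isRCLikeNormedField]; infer_instance
  have : IsManifold (𝓡 2) (((⊤ : ℕ∞) : ℕ∞ω) + 1) M := by simpa using ‹IsManifold (𝓡 2) ∞ M›
  exact ContMDiffAt.mlieBracket_vectorField (m := ⊤) (n := ⊤)
    X.contMDiff.contMDiffAt Y.contMDiff.contMDiffAt (by simp)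

/-- The Lie bracket of smooth vector fields. -/
def lieBracketField (X Y : VField M) : VField M :=
  ⟨fun x ↦ VectorField.mlieBracket (𝓡 2) X Y x, contMDiff_mlieBracket X Y⟩

omit [IsManifold (𝓡 2) ∞ M] in
theorem mvfderiv_comp_eq_fderiv {F G : Type*} [NormedAddCommGroup F] [NormedSpace ℝ F]
    [NormedAddCommGroup G] [NormedSpace ℝ G] {φ : F → G} {f : M → F} {x : M}
    (hφ : DifferentiableAt ℝ φ (f x)) (hf : MDifferentiableAt (𝓡 2) 𝓘(ℝ, F) f x)
    (v : TangentSpace (𝓡 2) x) :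
    mvfderiv (𝓡 2) (fun y ↦ φ (f y)) x v = fderiv ℝ φ (f x) (mvfderiv (𝓡 2) f x v) := by
  have h := (hφ.hasFDerivAt.hasMFDerivAt.comp x hf.hasMFDerivAt).mfderiv
  simp only [mvfderiv, ContinuousLinearMap.comp_apply]
  change _ = fderiv ℝ φ (f x) (mfderiv (𝓡 2) 𝓘(ℝ, F) f x v)
  change mfderiv (𝓡 2) 𝓘(ℝ, G) (φ ∘ f) x v = _
  rw [h]
  rfl

/-- A field of endomorphisms of `TM` is smooth if it maps smooth vector fields to smooth
vector fields. -/
theorem contMDiff_hom_of_apply [T2Space M]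
    {T : ∀ x : M, TangentSpace (𝓡 2) x →L[ℝ] TangentSpace (𝓡 2) x}
    (hT : ∀ X : VField M, ContMDiff (𝓡 2) (𝓡 2).tangent ∞
      (fun x ↦ (⟨x, T x (X x)⟩ : TangentBundle (𝓡 2) M))) :
    ContMDiff (𝓡 2) ((𝓡 2).prod 𝓘(ℝ, Plane →L[ℝ] Plane)) ∞
      (fun x ↦ (⟨x, T x⟩ : TotalSpace (Plane →L[ℝ] Plane)
        fun x : M ↦ TangentSpace (𝓡 2) x →L[ℝ] TangentSpace (𝓡 2) x)) := by
  intro x₀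
  rw [contMDiffAt_hom_bundle]
  refine ⟨contMDiffAt_id, ?_⟩
  set A : M → Plane →L[ℝ] Plane := fun x ↦
    ContinuousLinearMap.inCoordinates Plane (TangentSpace (𝓡 2) : M → Type) Plane
      (TangentSpace (𝓡 2) : M → Type) x₀ x x₀ x (T x) with hA
  -- Columns of the local matrix suffice: `T` is applied to a global field that near `x₀` has
  -- constant coordinates `e` in the trivialization.
  have key : ∀ e : Plane, ContMDiffAt (𝓡 2) 𝓘(ℝ, Plane) ∞ (fun x ↦ A x e) x₀ := by
    intro e
    set t := trivializationAt Plane (TangentSpace (𝓡 2) : M → Type) x₀ with ht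
    have hx₀ : x₀ ∈ t.baseSet := FiberBundle.mem_baseSet_trivializationAt' x₀
    obtain ⟨X, hX⟩ := exists_vField_eventuallyEq_extend (t.symmL ℝ x₀ e)
    have := (contMDiffAt_section _).1 ((hT X) x₀)
    refine this.congr_of_eventuallyEq ?_
    filter_upwards [hX, t.open_baseSet.mem_nhds hx₀] with x hx hxt
    rw [hA]
    simp only []
    rw [ContinuousLinearMap.inCoordinates_eq hxt hxt, hx]
    simp [FiberBundle.extend, hx₀, ← ht]
  set b := EuclideanSpace.basisFun (Fin 2) ℝ
  have h2 : A = fun x ↦ ∑ i, ContinuousLinearMap.smulRightL ℝ Plane Plane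
      (EuclideanSpace.proj i) (A x (b i)) := by
    funext x
    ext1 w
    conv_lhs => rw [← b.sum_repr w, map_sum]
    simp [b]
  rw [h2]
  refine contMDiffAt_finsetSum fun i _ ↦ ?_
  exact ((ContinuousLinearMap.smulRightL ℝ Plane Plane
      (EuclideanSpace.proj i)).contDiff.contMDiff.contMDiffAt).comp x₀ (key _)

end Smooth

/-! ### Linear algebra in a tangent plane -/

/-- Applying `J` to a relation `a e + b J e = 0` and combining gives `(a² + b²) e = 0`, so `e` and
`J e` are independent in a plane. -/
theorem ComplexStr.exists_eq_add (J : ComplexStr M) {x : M} {e : TangentSpace (𝓡 2) x}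
    (he : e ≠ 0) (v : TangentSpace (𝓡 2) x) : ∃ a b : ℝ, v = a • e + b • J.toFun x e := by
  have hfin : FiniteDimensional ℝ (TangentSpace (𝓡 2) x) :=
    inferInstanceAs (FiniteDimensional ℝ Plane)
  have hrank : Module.finrank ℝ (TangentSpace (𝓡 2) x) = 2 :=
    finrank_euclideanSpace_fin (𝕜 := ℝ) (n := 2)
  have hli : LinearIndependent ℝ ![e, J.toFun x e] := by
    rw [LinearIndependent.pair_iff]
    intro a b hab
    have h2 := congrArg (J.toFun x) hab
    simp only [map_add, map_smul, J.sq, map_zero] at h2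
    have h3 : (a * a + b * b) • e = 0 := by
      have : (a * a + b * b) • e = a • (a • e + b • J.toFun x e) - b •
          (a • J.toFun x e + b • -e) := by module
      rw [this, hab, h2]; simp
    have h4 := (smul_eq_zero.1 h3).resolve_right he
    exact ⟨by nlinarith [sq_nonneg a, sq_nonneg b], by nlinarith [sq_nonneg a, sq_nonneg b]⟩
  have htop := hli.span_eq_top_of_card_eq_finrank (by simp [hrank])
  have hv : v ∈ Submodule.span ℝ (Set.range ![e, J.toFun x e]) := htop ▸ Submodule.mem_top
  rw [Matrix.range_cons_cons_empty, Submodule.mem_span_pair] at hv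
  obtain ⟨a, b, h⟩ := hv
  exact ⟨a, b, h.symm⟩

section Isometry

variable {g : Metric M} {J : ComplexStr M}
  (hJ : ∀ (x : M) (v w : TangentSpace (𝓡 2) x),
    g.inner x (J.toFun x v) (J.toFun x w) = g.inner x v w)

include hJ in
theorem inner_J_left (x : M) (v w : TangentSpace (𝓡 2) x) :
    g.inner x (J.toFun x v) w = -g.inner x v (J.toFun x w) := by
  have := hJ x v (J.toFun x w)
  rw [J.sq, map_neg] at this
  linarith

include hJ in
theorem inner_J_self (x : M) (v : TangentSpace (𝓡 2) x) : g.inner x v (J.toFun x v) = 0 := by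
  have := inner_J_left hJ x v v
  rw [g.symm] at this
  linarith

include hJ in
theorem eq_of_inner_unit {x : M} {e : TangentSpace (𝓡 2) x} (he : g.inner x e e = 1)
    (v : TangentSpace (𝓡 2) x) :
    v = g.inner x v e • e + g.inner x v (J.toFun x e) • J.toFun x e := by
  have he0 : e ≠ 0 := by rintro rfl; simp at he
  obtain ⟨a, b, rfl⟩ := J.exists_eq_add he0 v
  have h1 := inner_J_self hJ x e
  have h2 : g.inner x (J.toFun x e) e = 0 := by rw [g.symm]; exact h1
  simp [he, h1, h2, hJ x e e]

end Isometry

theorem exists_unit_vField [T2Space M] (g : Metric M) (x : M) :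
    ∃ E : VField M, ∀ᶠ y in 𝓝 x, g.inner y (E y) (E y) = 1 := by
  let v : TangentSpace (𝓡 2) x := (EuclideanSpace.single 0 1 : Plane)
  have hv : v ≠ 0 := fun h ↦ by
    have h' : (EuclideanSpace.single 0 1 : Plane) = 0 := h
    simp at h'
  obtain ⟨X, hX⟩ := exists_vField_apply_eq v
  have hpos : ∀ᶠ y in 𝓝 x, 0 < g.inner y (X y) (X y) := by
    refine (g.contMDiff_inner X X).continuous.continuousAt.eventually_const_lt ?_
    change 0 < g.inner x (X x) (X x)
    rw [hX]; exact g.pos x v hv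
  obtain ⟨f, hf⟩ := exists_contMDiffMap_eventuallyEq (x := x)
    (f := fun y ↦ (Real.sqrt (g.inner y (X y) (X y)))⁻¹) (by
      filter_upwards [hpos] with y hy
      have h1 : ContDiffAt ℝ ∞ (fun t : ℝ ↦ (Real.sqrt t)⁻¹) (g.inner y (X y) (X y)) :=
        (Real.contDiffAt_sqrt hy.ne').inv (Real.sqrt_pos.2 hy).ne'
      exact ContMDiffAt.comp (g := fun t : ℝ ↦ (Real.sqrt t)⁻¹) y h1.contMDiffAt (g.contMDiff_inner X X y))
  refine ⟨⟨fun y ↦ f y • X y, f.contMDiff.smul_section X.contMDiff⟩, ?_⟩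
  filter_upwards [hpos, hf] with y hy hfy
  change g.inner y (f y • X y) (f y • X y) = 1
  simp only [map_smul, smul_apply, smul_eq_mul]
  rw [hfy]
  have := Real.mul_self_sqrt hy.le
  have h0 := (Real.sqrt_pos.2 hy).ne'
  field_simp
  rw [sq, this]

/-! ### The Weyl connection of a 1-form in a unit frame -/

section Frame

variable (g : Metric M) (J : ComplexStr M) (θ : OneForm M) (E : VField M)

/-- The rotation form `v ↦ θ(J v) - g([E, J E], v)` of the Weyl connection with `∇ g = 2 θ ⊗ g`
in the frame `E, J E`. -/
def rotationForm (x : M) : TangentSpace (𝓡 2) x →L[ℝ] ℝ :=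
  (θ.toFun x).comp (J.toFun x) - g.inner x (VectorField.mlieBracket (𝓡 2) E (J.mapField E) x)

/-- The Weyl connection with `∇ g = 2 θ ⊗ g` near the points around which `E` is a unit vector
field, written in the frame `E, J E`. -/
def frameDeriv (Y : ∀ x : M, TangentSpace (𝓡 2) x) (x : M) :
    TangentSpace (𝓡 2) x →L[ℝ] TangentSpace (𝓡 2) x :=
  (mvfderiv (𝓡 2) (fun y ↦ g.inner y (Y y) (E y)) x).smulRight (E x)
    + (mvfderiv (𝓡 2) (fun y ↦ g.inner y (Y y) (J.toFun y (E y))) x).smulRight (J.toFun x (E x))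
    - (θ.toFun x).smulRight (Y x) + (rotationForm g J θ E x).smulRight (J.toFun x (Y x))

theorem frameDeriv_apply (Y : ∀ x : M, TangentSpace (𝓡 2) x) (x : M) (v : TangentSpace (𝓡 2) x) :
    frameDeriv g J θ E Y x v =
      mvfderiv (𝓡 2) (fun y ↦ g.inner y (Y y) (E y)) x v • E x
      + mvfderiv (𝓡 2) (fun y ↦ g.inner y (Y y) (J.toFun y (E y))) x v • J.toFun x (E x)
      - θ.toFun x v • Y x + rotationForm g J θ E x v • J.toFun x (Y x) := rfl

variable {g J θ E}
  (hJ : ∀ (x : M) (v w : TangentSpace (𝓡 2) x),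
    g.inner x (J.toFun x v) (J.toFun x w) = g.inner x v w)

omit [IsManifold (𝓡 2) ∞ M] in
theorem eventuallyEq_mvfderiv {F : Type*} [NormedAddCommGroup F] [NormedSpace ℝ F] {f f' : M → F}
    {x : M} (h : ∀ᶠ y in 𝓝 x, f y = f' y) : mvfderiv (𝓡 2) f x = mvfderiv (𝓡 2) f' x := by
  have h1 : f =ᶠ[𝓝 x] f' := h
  ext v
  simp only [mvfderiv, ContinuousLinearMap.comp_apply]
  rw [h1.mfderiv_eq]
  rfl

omit [IsManifold (𝓡 2) ∞ M] in
theorem mvfderiv_eq_zero_of_eventually_const {F : Type*} [NormedAddCommGroup F] [NormedSpace ℝ F]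
    {f : M → F} {x : M} {c : F} (h : ∀ᶠ y in 𝓝 x, f y = c) : mvfderiv (𝓡 2) f x = 0 := by
  rw [eventuallyEq_mvfderiv h, mvfderiv_const]

include hJ in
/-- A torsion-free connection with `∇ g = 2 θ ⊗ g` is determined by `g` and `θ`. -/
theorem eq_frameDeriv {D : CovariantDerivative (𝓡 2) Plane (TangentSpace (𝓡 2) : M → Type)}
    (htor : D.torsion = 0) (hmet : NablaMetricEq D g θ) {x : M}
    (hE : ∀ᶠ y in 𝓝 x, g.inner y (E y) (E y) = 1) {Y : ∀ x : M, TangentSpace (𝓡 2) x}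
    (hY : MDifferentiableAt (𝓡 2) (𝓡 2).tangent (fun y ↦ (⟨y, Y y⟩ : TangentBundle (𝓡 2) M)) x) :
    D Y x = frameDeriv g J θ E Y x := by
  have hEx := hE.self_of_nhds
  have hEd := mdifferentiableAt_vField E x
  have hFd := mdifferentiableAt_vField (J.mapField E) x
  set e := E x with he
  set f := J.toFun x e with hf
  have hff : g.inner x f f = 1 := by rw [hf, hJ, hEx]
  have hef : g.inner x e f = 0 := inner_J_self hJ x e
  have hfe : g.inner x f e = 0 := by rw [g.symm]; exact hef
  have m1 : ∀ v, g.inner x (D E x v) e = -θ.toFun x v := fun v ↦ by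
    have := hmet E E x v
    rw [mvfderiv_eq_zero_of_eventually_const hE, g.symm x (E x)] at this
    simp only [zero_apply, ← he, hEx] at this
    linarith
  have m2 : ∀ v, g.inner x (D (J.mapField E) x v) f = -θ.toFun x v := fun v ↦ by
    have := hmet (J.mapField E) (J.mapField E) x v
    rw [mvfderiv_eq_zero_of_eventually_const (c := 1)
      (by filter_upwards [hE] with y hy; simp [hJ, hy]), g.symm x (J.mapField E x)] at this
    simp only [zero_apply, J.mapField_apply, ← he, ← hf, hff] at this
    linarith
  have m3 : ∀ v, g.inner x (D (J.mapField E) x v) e = -g.inner x (D E x v) f := fun v ↦ by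
    have := hmet E (J.mapField E) x v
    rw [mvfderiv_eq_zero_of_eventually_const (c := 0)
      (by filter_upwards with y; simp [inner_J_self hJ]), g.symm x (E x)] at this
    simp only [zero_apply, J.mapField_apply, ← he, ← hf, hef] at this
    linarith
  -- The metric equation has left one unknown form, `v ↦ g(∇_v E, J E)`. The two components of the
  -- torsion equation for `E, J E` give its values on `e` and `f`.
  have ht := CovariantDerivative.torsion_eq_zero_iff D |>.1 htor hEd hFd
  simp only [J.mapField_apply, ← he, ← hf] at ht
  have hq : ∀ v, g.inner x (D E x v) f = rotationForm g J θ E x v := by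
    intro v
    have q1 : g.inner x (D E x e) f = rotationForm g J θ E x e := by
      simp only [rotationForm, sub_apply, ContinuousLinearMap.comp_apply, ← ht,
        map_sub, m1, m3, ← hf]
      ring
    have q2 : g.inner x (D E x f) f = rotationForm g J θ E x f := by
      simp only [rotationForm, sub_apply, ContinuousLinearMap.comp_apply, ← ht,
        map_sub, m2]
      rw [hf, J.sq, ← hf, map_neg]
      ring
    rw [eq_of_inner_unit hJ hEx v]
    simp only [map_add, map_smul, add_apply, smul_apply]
    rw [← hf, q1, q2]
  have dE : ∀ v, D E x v = -θ.toFun x v • e + rotationForm g J θ E x v • f := fun v ↦ by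
    rw [eq_of_inner_unit hJ hEx (D E x v), ← hf, m1, hq]
  have dF : ∀ v, D (J.mapField E) x v = -rotationForm g J θ E x v • e - θ.toFun x v • f :=
    fun v ↦ by
      rw [eq_of_inner_unit hJ hEx (D (J.mapField E) x v), ← hf, m2, m3, hq]; module
  have y1 := g.mdifferentiableAt_inner hY hEd
  have y2 := g.mdifferentiableAt_inner hY hFd
  have hs1 := y1.smul_section hEd
  have hs2 := y2.smul_section hFd
  -- The frame expansion of `Y` holds only near `x`, where `E` has length one; locality of `D` is
  -- what permits substituting it.
  have hdecomp : D Y x = D ((fun y ↦ g.inner y (Y y) (E y)) • ⇑E +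
      (fun y ↦ g.inner y (Y y) (J.mapField E y)) • ⇑(J.mapField E)) x := by
    refine D.isCovariantDerivativeOnUniv.congr_of_eventuallyEq hY
      (mdifferentiableAt_add_section hs1 hs2) Filter.univ_mem ?_
    filter_upwards [hE] with y hy
    exact eq_of_inner_unit hJ hy (Y y)
  rw [hdecomp, D.isCovariantDerivativeOnUniv.add hs1 hs2,
    D.isCovariantDerivativeOnUniv.leibniz hEd y1, D.isCovariantDerivativeOnUniv.leibniz hFd y2]
  ext1 v
  rw [frameDeriv_apply]
  have hYx := eq_of_inner_unit hJ hEx (Y x)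
  have hJY : J.toFun x (Y x) = g.inner x (Y x) e • f - g.inner x (Y x) f • e := by
    conv_lhs => rw [hYx]
    simp only [map_add, map_smul, ← hf, show J.toFun x f = -e by rw [hf, J.sq]]
    module
  rw [hJY]
  conv_rhs => enter [1, 2]; rw [hYx]
  simp only [add_apply, smul_apply,
    ContinuousLinearMap.smulRight_apply, J.mapField_apply, ← he, ← hf, dE, dF]
  module

theorem frameDeriv_add {x : M} {Y Z : ∀ x : M, TangentSpace (𝓡 2) x}
    (hY : MDifferentiableAt (𝓡 2) (𝓡 2).tangent (fun y ↦ (⟨y, Y y⟩ : TangentBundle (𝓡 2) M)) x)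
    (hZ : MDifferentiableAt (𝓡 2) (𝓡 2).tangent (fun y ↦ (⟨y, Z y⟩ : TangentBundle (𝓡 2) M)) x) :
    frameDeriv g J θ E (Y + Z) x = frameDeriv g J θ E Y x + frameDeriv g J θ E Z x := by
  have hEd := mdifferentiableAt_vField E x
  have hFd := mdifferentiableAt_vField (J.mapField E) x
  ext1 v
  have h1 := mvfderiv_fun_add (g.mdifferentiableAt_inner hY hEd) (g.mdifferentiableAt_inner hZ hEd)
  have h2 := mvfderiv_fun_add (g.mdifferentiableAt_inner hY hFd) (g.mdifferentiableAt_inner hZ hFd)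
  simp only [J.mapField_apply] at h2
  simp only [add_apply, frameDeriv_apply, Pi.add_apply, map_add, h1, h2]
  module

include hJ in
-- Differentiating the two components produces `df` times the components of `Y`, which reassemble to
-- `Y` in the orthonormal frame at `x`; the remaining terms are tensorial in `Y`.
theorem frameDeriv_smul {x : M} (hE : g.inner x (E x) (E x) = 1)
    {Y : ∀ x : M, TangentSpace (𝓡 2) x} {f : M → ℝ}
    (hY : MDifferentiableAt (𝓡 2) (𝓡 2).tangent (fun y ↦ (⟨y, Y y⟩ : TangentBundle (𝓡 2) M)) x)
    (hf : MDifferentiableAt (𝓡 2) 𝓘(ℝ, ℝ) f x) :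
    frameDeriv g J θ E (f • Y) x =
      f x • frameDeriv g J θ E Y x + (mvfderiv (𝓡 2) f x).smulRight (Y x) := by
  have hEd := mdifferentiableAt_vField E x
  have hFd := mdifferentiableAt_vField (J.mapField E) x
  ext1 v
  have h1 := mvfderiv_fun_mul hf (g.mdifferentiableAt_inner hY hEd)
  have h2 := mvfderiv_fun_mul hf (g.mdifferentiableAt_inner hY hFd)
  simp only [J.mapField_apply] at h2
  simp only [add_apply, smul_apply,
    ContinuousLinearMap.smulRight_apply, frameDeriv_apply, Pi.smul_apply', map_smul, h1, h2,
    smul_eq_mul]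
  conv_rhs => enter [2, 2]; rw [eq_of_inner_unit hJ hE (Y x)]
  module

include hJ in
-- Differentiating components is a metric connection by Parseval in the frame. The term `-θ`
-- contributes `2 θ ⊗ g`, and the rotation term drops out because `J` is skew.
theorem frameDeriv_nablaMetric {x : M} (hE : ∀ᶠ y in 𝓝 x, g.inner y (E y) (E y) = 1)
    (Y Z : VField M) (v : TangentSpace (𝓡 2) x) :
    mvfderiv (𝓡 2) (fun y ↦ g.inner y (Y y) (Z y)) x v
        - g.inner x (frameDeriv g J θ E Y x v) (Z x) - g.inner x (Y x) (frameDeriv g J θ E Z x v)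
      = 2 * θ.toFun x v * g.inner x (Y x) (Z x) := by
  have hEx := hE.self_of_nhds
  have hEd := mdifferentiableAt_vField E x
  have hFd := mdifferentiableAt_vField (J.mapField E) x
  have hYd := mdifferentiableAt_vField Y x
  have hZd := mdifferentiableAt_vField Z x
  have a1 := g.mdifferentiableAt_inner hYd hEd
  have a2 := g.mdifferentiableAt_inner hYd hFd
  have b1 := g.mdifferentiableAt_inner hZd hEd
  have b2 := g.mdifferentiableAt_inner hZd hFd
  have hpar : ∀ y, g.inner y (E y) (E y) = 1 → g.inner y (Y y) (Z y) =
      g.inner y (Y y) (E y) * g.inner y (Z y) (E y) +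
      g.inner y (Y y) (J.mapField E y) * g.inner y (Z y) (J.mapField E y) := by
    intro y hy
    conv_lhs => rw [eq_of_inner_unit hJ hy (Z y)]
    simp only [map_add, map_smul, smul_eq_mul, J.mapField_apply]
    ring
  have hsum := mvfderiv_fun_add (a1.mul b1) (a2.mul b2)
  simp only [Pi.mul_apply] at hsum
  rw [eventuallyEq_mvfderiv (hE.mono hpar), hsum, mvfderiv_mul a1 b1, mvfderiv_mul a2 b2]
  have hs := g.symm x
  have hJ2 := inner_J_left hJ x (Y x) (Z x)
  simp only [frameDeriv_apply, map_add, map_sub, map_smul, add_apply,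
    sub_apply, smul_apply, smul_eq_mul, J.mapField_apply,
    hs (E x) (Z x), hs (J.toFun x (E x)) (Z x), hJ2]
  ring

include hJ in
-- The components of `E` and `J E` in the frame are constant, so only the `θ` and rotation terms
-- survive; `rotationForm` is chosen so that they add up to the bracket.
theorem frameDeriv_torsion {x : M} (hE : ∀ᶠ y in 𝓝 x, g.inner y (E y) (E y) = 1) :
    frameDeriv g J θ E (J.mapField E) x (E x) - frameDeriv g J θ E E x (J.toFun x (E x)) =
      VectorField.mlieBracket (𝓡 2) E (J.mapField E) x := by
  have hEx := hE.self_of_nhds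
  have c1 : ∀ᶠ y in 𝓝 x, g.inner y (J.toFun y (E y)) (J.toFun y (E y)) = 1 := by
    filter_upwards [hE] with y hy; simp [hJ, hy]
  have c2 : ∀ᶠ y in 𝓝 x, g.inner y (J.toFun y (E y)) (E y) = 0 := by
    filter_upwards with y; rw [g.symm]; exact inner_J_self hJ y (E y)
  have c3 : ∀ᶠ y in 𝓝 x, g.inner y (E y) (J.toFun y (E y)) = 0 := by
    filter_upwards with y; exact inner_J_self hJ y (E y)
  simp only [frameDeriv_apply, mvfderiv_eq_zero_of_eventually_const c1,
    mvfderiv_eq_zero_of_eventually_const c2, mvfderiv_eq_zero_of_eventually_const c3,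
    mvfderiv_eq_zero_of_eventually_const hE, zero_apply, J.mapField_apply, J.sq]
  conv_rhs => rw [eq_of_inner_unit hJ hEx (VectorField.mlieBracket (𝓡 2) E (J.mapField E) x)]
  simp only [rotationForm, sub_apply, ContinuousLinearMap.comp_apply, J.sq,
    map_neg]
  module

end Frame

section Weyl

/-! ### The Weyl connection of a 1-form -/

theorem OneForm.ext' {θ θ' : OneForm M} (h : ∀ x v, θ.toFun x v = θ'.toFun x v) : θ = θ' := by
  obtain ⟨a, ha⟩ := θ
  obtain ⟨b, hb⟩ := θ'
  obtain rfl : a = b := funext fun x ↦ ContinuousLinearMap.ext (h x)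
  rfl

theorem ConformalConnection.ext' {g : Metric M} {C C' : ConformalConnection g}
    (h : C.conn = C'.conn) : C = C' := by
  obtain ⟨a, _, _, _, _⟩ := C
  obtain ⟨b, _, _, _, _⟩ := C'
  obtain rfl : a = b := h
  rfl

/-- A smooth vector field which has length `1` near `x`. -/
def unitField [T2Space M] (g : Metric M) (x : M) : VField M := (exists_unit_vField g x).choose

theorem eventually_unitField [T2Space M] (g : Metric M) (x : M) :
    ∀ᶠ y in 𝓝 x, g.inner y (unitField g x y) (unitField g x y) = 1 :=
  (exists_unit_vField g x).choose_spec

theorem unitField_self [T2Space M] (g : Metric M) (x : M) :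
    g.inner x (unitField g x x) (unitField g x x) = 1 := (eventually_unitField g x).self_of_nhds

theorem unitField_ne_zero [T2Space M] (g : Metric M) (x : M) : unitField g x x ≠ 0 := fun h ↦ by
  simpa [h] using unitField_self g x

variable [T2Space M] {g : Metric M} {J : ComplexStr M}
  (hJ : ∀ (x : M) (v w : TangentSpace (𝓡 2) x),
    g.inner x (J.toFun x v) (J.toFun x w) = g.inner x v w)

open scoped Classical in
/-- The torsion-free connection with `∇ g = 2 θ ⊗ g`. -/
def weylConn (θ : OneForm M) :
    CovariantDerivative (𝓡 2) Plane (TangentSpace (𝓡 2) : M → Type) where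
  -- Each point uses its own unit field, so linearity and Leibniz are pointwise checks. The value
  -- `0` at points of non-differentiability is the one required by `normalized`.
  toFun Y x :=
    if MDifferentiableAt (𝓡 2) (𝓡 2).tangent (fun y ↦ (⟨y, Y y⟩ : TangentBundle (𝓡 2) M)) x
    then frameDeriv g J θ (unitField g x) Y x else 0
  isCovariantDerivativeOnUniv :=
    { add := fun {Y Z x} hY hZ _ ↦ by
        rw [if_pos hY, if_pos hZ, if_pos (mdifferentiableAt_add_section hY hZ)]
        exact frameDeriv_add hY hZ
      leibniz := fun {Y f x} hY hf _ ↦ by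
        rw [if_pos hY, if_pos (hf.smul_section hY)]
        exact frameDeriv_smul hJ (unitField_self g x) hY hf }

theorem weylConn_of_mdifferentiableAt (θ : OneForm M) {Y : ∀ x : M, TangentSpace (𝓡 2) x} {x : M}
    (hY : MDifferentiableAt (𝓡 2) (𝓡 2).tangent
      (fun y ↦ (⟨y, Y y⟩ : TangentBundle (𝓡 2) M)) x) :
    weylConn hJ θ Y x = frameDeriv g J θ (unitField g x) Y x := if_pos hY

theorem weylConn_of_not_mdifferentiableAt (θ : OneForm M) {Y : ∀ x : M, TangentSpace (𝓡 2) x}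
    {x : M} (hY : ¬ MDifferentiableAt (𝓡 2) (𝓡 2).tangent
      (fun y ↦ (⟨y, Y y⟩ : TangentBundle (𝓡 2) M)) x) :
    weylConn hJ θ Y x = 0 := if_neg hY

/-- Torsion is an antisymmetric tensor, so on a plane it suffices to test it on the pair `E, J E`.
-/
theorem weylConn_torsion (θ : OneForm M) : (weylConn hJ θ).torsion = 0 := by
  funext x
  have hE := eventually_unitField g x
  set E := unitField g x with hEdef
  have h0 : (weylConn hJ θ).torsion x (E x) (J.toFun x (E x)) = 0 := by
    have h1 := (weylConn hJ θ).torsion_apply (mdifferentiableAt_vField E x)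
      (mdifferentiableAt_vField (J.mapField E) x)
    rw [J.mapField_apply] at h1
    rw [h1, weylConn_of_mdifferentiableAt hJ θ (mdifferentiableAt_vField E x),
      weylConn_of_mdifferentiableAt hJ θ (mdifferentiableAt_vField (J.mapField E) x), ← hEdef,
      frameDeriv_torsion hJ hE, sub_self]
  have h0' : (weylConn hJ θ).torsion x (J.toFun x (E x)) (E x) = 0 := by
    rw [CovariantDerivative.torsion_antisymm, h0, neg_zero]
  ext1 v
  ext1 w
  obtain ⟨a, b, rfl⟩ := J.exists_eq_add (unitField_ne_zero g x) v
  obtain ⟨c, d, rfl⟩ := J.exists_eq_add (unitField_ne_zero g x) w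
  simp [← hEdef, h0, h0']

theorem weylConn_nablaMetricEq (θ : OneForm M) : NablaMetricEq (weylConn hJ θ) g θ := by
  intro Y Z x v
  rw [weylConn_of_mdifferentiableAt hJ θ (mdifferentiableAt_vField Y x),
    weylConn_of_mdifferentiableAt hJ θ (mdifferentiableAt_vField Z x)]
  exact frameDeriv_nablaMetric hJ (eventually_unitField g x) Y Z v

omit [T2Space M] in
theorem contMDiff_frameDeriv_apply (θ : OneForm M) (E X Y : VField M) :
    ContMDiff (𝓡 2) (𝓡 2).tangent ∞
      (fun x ↦ (⟨x, frameDeriv g J θ E Y x (X x)⟩ : TangentBundle (𝓡 2) M)) := by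
  have hq : ContMDiff (𝓡 2) 𝓘(ℝ, ℝ) ∞ (fun x ↦ rotationForm g J θ E x (X x)) :=
    (θ.smooth (J.mapField X)).sub (g.contMDiff_inner (lieBracketField E (J.mapField E)) X)
  exact ((((contMDiff_mvfderiv_apply (g.contMDiff_inner Y E) X).smul_section
    E.contMDiff).add_section ((contMDiff_mvfderiv_apply (g.contMDiff_inner Y (J.mapField E))
    X).smul_section (J.mapField E).contMDiff)).sub_section ((θ.smooth X).smul_section
    Y.contMDiff)).add_section (hq.smul_section (J.mapField Y).contMDiff)

/-- The unit field in the definition varies uncontrollably with the point, but by uniqueness any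
local unit field computes the same connection. Near `x` the single field chosen at `x` may therefore
be used. -/
theorem contMDiff_weylConn_apply (θ : OneForm M) (X Y : VField M) :
    ContMDiff (𝓡 2) (𝓡 2).tangent ∞
      (fun x ↦ (⟨x, weylConn hJ θ Y x (X x)⟩ : TangentBundle (𝓡 2) M)) := by
  intro x
  refine (contMDiff_frameDeriv_apply (g := g) (J := J) θ (unitField g x) X Y
    x).congr_of_eventuallyEq ?_
  filter_upwards [(eventually_unitField g x).eventually_nhds] with y hy
  rw [eq_frameDeriv hJ (weylConn_torsion hJ θ) (weylConn_nablaMetricEq hJ θ) hy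
    (mdifferentiableAt_vField Y y)]

theorem NablaMetricEq.form_eq {D : CovariantDerivative (𝓡 2) Plane (TangentSpace (𝓡 2) : M → Type)}
    {θ θ' : OneForm M} (h : NablaMetricEq D g θ) (h' : NablaMetricEq D g θ') : θ = θ' := by
  refine OneForm.ext' fun x v ↦ ?_
  have := (h (unitField g x) (unitField g x) x v).symm.trans
    (h' (unitField g x) (unitField g x) x v)
  rw [unitField_self] at this
  linarith

/-- The conformal connection of a 1-form. -/
def weyl (θ : OneForm M) : ConformalConnection g where
  conn := weylConn hJ θ
  normalized _ _ hY := weylConn_of_not_mdifferentiableAt hJ θ hY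
  smooth := ⟨⟨fun {σ} hσ ↦ by
    have hσ' : ContMDiff (𝓡 2) (𝓡 2).tangent ∞
        (fun x ↦ (⟨x, σ x⟩ : TangentBundle (𝓡 2) M)) := contMDiffOn_univ.1 (by simpa using hσ)
    exact (contMDiff_hom_of_apply fun X ↦
      contMDiff_weylConn_apply hJ θ X ⟨σ, hσ'⟩).contMDiffOn⟩⟩
  torsion_free := weylConn_torsion hJ θ
  conformal := ⟨g, ⟨0, fun x v w ↦ by simp⟩, θ, weylConn_nablaMetricEq hJ θ⟩

omit [T2Space M] in
/-- `∇ h = 2 θ ⊗ h` for `h = e^{2u} g` means `∇ g = 2 (θ - du) ⊗ g`. -/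
theorem exists_nablaMetricEq_of_conformal {h : Metric M} (hgh : InConformalClass g h)
    {D : CovariantDerivative (𝓡 2) Plane (TangentSpace (𝓡 2) : M → Type)} {θ : OneForm M}
    (hD : NablaMetricEq D h θ) : ∃ θ' : OneForm M, NablaMetricEq D g θ' := by
  obtain ⟨u, hu⟩ := hgh
  refine ⟨⟨fun x ↦ θ.toFun x - mvfderiv (𝓡 2) u x, fun X ↦
    (θ.smooth X).sub (contMDiff_mvfderiv_apply u.contMDiff X)⟩, fun Y Z x v ↦ ?_⟩
  have h1 := hD Y Z x v
  have hud : MDifferentiableAt (𝓡 2) 𝓘(ℝ, ℝ) u x := u.contMDiff.mdifferentiable (by simp) x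
  have hgd := g.mdifferentiableAt_inner (mdifferentiableAt_vField Y x)
    (mdifferentiableAt_vField Z x)
  have hexp : HasDerivAt (fun t : ℝ ↦ Real.exp (2 * t)) (Real.exp (2 * u x) * 2) (u x) := by
    simpa using ((hasDerivAt_id (u x)).const_mul 2).exp
  have hed : MDifferentiableAt (𝓡 2) 𝓘(ℝ, ℝ) (fun y ↦ Real.exp (2 * u y)) x :=
    MDifferentiableAt.comp (g := fun t : ℝ ↦ Real.exp (2 * t)) x
      hexp.differentiableAt.mdifferentiableAt hud
  have hdexp : mvfderiv (𝓡 2) (fun y ↦ Real.exp (2 * u y)) x v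
      = Real.exp (2 * u x) * 2 * mvfderiv (𝓡 2) u x v := by
    rw [mvfderiv_comp_eq_fderiv (φ := fun t : ℝ ↦ Real.exp (2 * t)) hexp.differentiableAt hud v,
      hexp.hasFDerivAt.fderiv]
    simp [mul_comm]
  simp only [hu] at h1
  rw [mvfderiv_fun_mul hed hgd] at h1
  simp only [add_apply, smul_apply, smul_eq_mul, hdexp] at h1
  have hpos := Real.exp_pos (2 * u x)
  apply mul_left_cancel₀ hpos.ne'
  simp only [sub_apply]
  linarith

/-- The equation `∇ g = 2 θ ⊗ g` recovers `θ`, hence injectivity. For surjectivity, pass from `h` to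
`g`, then use uniqueness on differentiable fields and the normalization on the others. -/
theorem weyl_bijective : Function.Bijective (weyl hJ : OneForm M → ConformalConnection g) := by
  refine ⟨fun θ θ' h ↦ ?_, fun C ↦ ?_⟩
  · have h1 := weylConn_nablaMetricEq hJ θ
    rw [show weylConn hJ θ = weylConn hJ θ' from congrArg ConformalConnection.conn h] at h1
    exact h1.form_eq (weylConn_nablaMetricEq hJ θ')
  · obtain ⟨h, hgh, θ, hθ⟩ := C.conformal
    obtain ⟨θ', hθ'⟩ := exists_nablaMetricEq_of_conformal hgh hθ
    refine ⟨θ', ConformalConnection.ext' ?_⟩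
    ext1
    funext Y x
    by_cases hY : MDifferentiableAt (𝓡 2) (𝓡 2).tangent
      (fun y ↦ (⟨y, Y y⟩ : TangentBundle (𝓡 2) M)) x
    · exact (eq_frameDeriv hJ (weylConn_torsion hJ θ') (weylConn_nablaMetricEq hJ θ')
        (eventually_unitField g x) hY).trans
        (eq_frameDeriv hJ C.torsion_free hθ' (eventually_unitField g x) hY).symm
    · exact (weylConn_of_not_mdifferentiableAt hJ θ' hY).trans (C.normalized Y x hY).symm

end Weyl

section Area

/-! ### Area forms -/

omit [IsManifold (𝓡 2) ∞ M] in
theorem alternating_swap {x : M} (η : TangentSpace (𝓡 2) x [⋀^Fin 2]→L[ℝ] ℝ)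
    (v w : TangentSpace (𝓡 2) x) : η ![v, w] = -η ![w, v] := by
  have := η.toAlternatingMap.map_swap ![w, v] (i := 0) (j := 1) (by decide)
  simp only [ContinuousAlternatingMap.coe_toAlternatingMap] at this
  rw [← this]
  congr 1
  ext i : 1
  fin_cases i <;> simp

omit [IsManifold (𝓡 2) ∞ M] in
theorem alternating_self {x : M} (η : TangentSpace (𝓡 2) x [⋀^Fin 2]→L[ℝ] ℝ)
    (v : TangentSpace (𝓡 2) x) : η ![v, v] = 0 := by
  have := alternating_swap η v v
  linarith

omit [IsManifold (𝓡 2) ∞ M] in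
theorem alternating_left {x : M} (η : TangentSpace (𝓡 2) x [⋀^Fin 2]→L[ℝ] ℝ) (a b : ℝ)
    (v v' w : TangentSpace (𝓡 2) x) :
    η ![a • v + b • v', w] = a * η ![v, w] + b * η ![v', w] := by
  have h1 := η.cons_add ![w] (a • v) (b • v')
  have h2 := η.cons_smul ![w] a v
  have h3 := η.cons_smul ![w] b v'
  exact h1.trans (congrArg₂ (· + ·) h2 h3)

omit [IsManifold (𝓡 2) ∞ M] in
theorem alternating_right {x : M} (η : TangentSpace (𝓡 2) x [⋀^Fin 2]→L[ℝ] ℝ) (a b : ℝ)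
    (v w w' : TangentSpace (𝓡 2) x) :
    η ![v, a • w + b • w'] = a * η ![v, w] + b * η ![v, w'] := by
  rw [alternating_swap, alternating_left, alternating_swap η w, alternating_swap η w']
  ring

omit [IsManifold (𝓡 2) ∞ M] in
theorem alternating_comb {x : M} (η : TangentSpace (𝓡 2) x [⋀^Fin 2]→L[ℝ] ℝ) (a b c d : ℝ)
    (v w : TangentSpace (𝓡 2) x) :
    η ![a • v + b • w, c • v + d • w] = (a * d - b * c) * η ![v, w] := by
  rw [alternating_left, alternating_right, alternating_right, alternating_self, alternating_self,
    alternating_swap η w v]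
  ring

variable {g : Metric M} {J : ComplexStr M}
  (hJ : ∀ (x : M) (v w : TangentSpace (𝓡 2) x),
    g.inner x (J.toFun x v) (J.toFun x w) = g.inner x v w)

/-- The area form `(v, w) ↦ g(J v, w)` of the metric. -/
def metricArea (x : M) : PosForm J x where
  val :=
    { toFun := fun v ↦ g.inner x (J.toFun x (v 0)) (v 1)
      map_update_add' := fun m i v w ↦ by fin_cases i <;> simp
      map_update_smul' := fun m i c v ↦ by fin_cases i <;> simp
      cont := by
        let B : Plane →L[ℝ] Plane →L[ℝ] ℝ := g.inner x
        exact B.continuous₂.comp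
          (((J.toFun x).continuous.comp (continuous_apply 0)).prodMk (continuous_apply 1))
      map_eq_zero_of_eq' := fun v i j hv hij ↦ by
        have h : v 0 = v 1 := by
          fin_cases i <;> fin_cases j <;> first | exact absurd rfl hij | exact hv | exact hv.symm
        simp only [h]
        rw [g.symm]
        exact inner_J_self hJ x (v 1) }
  property := fun v hv ↦ by
    change 0 < g.inner x (J.toFun x v) (J.toFun x v)
    rw [hJ]
    exact g.pos x v hv

theorem metricArea_apply (x : M) (v w : TangentSpace (𝓡 2) x) :
    (metricArea hJ x).1 ![v, w] = g.inner x (J.toFun x v) w := rfl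

/-- The smooth area form of the metric. -/
def metricAreaForm : AreaForm J where
  toFun := metricArea hJ
  smooth X Y := g.contMDiff_inner (J.mapField X) Y

variable [T2Space M]

/-- The quotient of an area form at `x` by the area form of the metric. -/
def areaRatio (g : Metric M) {x : M} (η : PosForm J x) : ℝ :=
  η.1 ![unitField g x x, J.toFun x (unitField g x x)]

theorem areaRatio_pos {x : M} (η : PosForm J x) : 0 < areaRatio g η :=
  η.2 _ (unitField_ne_zero g x)

include hJ in
theorem apply_eq_areaRatio_mul {x : M} (η : PosForm J x) (v w : TangentSpace (𝓡 2) x) :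
    η.1 ![v, w] = areaRatio g η * g.inner x (J.toFun x v) w := by
  have hE := unitField_self g x
  rw [← metricArea_apply hJ]
  set e := unitField g x x with he
  rw [eq_of_inner_unit hJ hE v, eq_of_inner_unit hJ hE w, alternating_comb, alternating_comb,
    metricArea_apply, hJ, hE, areaRatio]
  ring

theorem eq_areaRatio_smul {x : M} (η : PosForm J x) :
    η.1 = areaRatio g η • (metricArea hJ x).1 := by
  ext v
  have hv : v = ![v 0, v 1] := by ext i : 1; fin_cases i <;> rfl
  rw [hv, apply_eq_areaRatio_mul hJ]
  rfl

theorem areaRatio_metricArea (x : M) : areaRatio g (metricArea hJ x) = 1 := by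
  rw [areaRatio, metricArea_apply, hJ, unitField_self]

theorem areaRatio_smul {x : M} {η η' : PosForm J x} {c : ℝ} (h : η'.1 = c • η.1) :
    areaRatio g η' = c * areaRatio g η := by
  simp [areaRatio, h]

include hJ in
-- Any unit vector gives the same ratio, so the pointwise chosen frame can be replaced locally by
-- one smooth frame.
theorem contMDiff_areaRatio (η : AreaForm J) :
    ContMDiff (𝓡 2) 𝓘(ℝ, ℝ) ∞ (fun x ↦ areaRatio g (η.toFun x)) := by
  intro x
  refine (η.smooth (unitField g x) (J.mapField (unitField g x)) x).congr_of_eventuallyEq ?_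
  filter_upwards [eventually_unitField g x] with y hy
  rw [apply_eq_areaRatio_mul hJ, J.mapField_apply, hJ, hy, mul_one]

/-! ### The section of `Λ²(TM)^s ⊗ ℂ` dual to the area form -/

/-- The element `η ↦ (η / ω)^s` of the fibre, `ω` being the area form of the metric. -/
def areaPow (g : Metric M) (J : ComplexStr M) (s : ℝ) (x : M) : Fibre J s x :=
  ⟨fun η ↦ ((areaRatio g η ^ s : ℝ) : ℂ), fun η η' c hc h ↦ by
    beta_reduce
    rw [areaRatio_smul h, Real.mul_rpow hc.le (areaRatio_pos η).le]
    push_cast; rfl⟩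

theorem areaPow_apply (s : ℝ) {x : M} (η : PosForm J x) :
    (areaPow g J s x).1 η = ((areaRatio g η ^ s : ℝ) : ℂ) := rfl

theorem areaPow_metricArea (s : ℝ) (x : M) : (areaPow g J s x).1 (metricArea hJ x) = 1 := by
  rw [areaPow_apply, areaRatio_metricArea, Real.one_rpow, Complex.ofReal_one]

/-- All positive forms at `x` are positive multiples of `ω`, so homogeneity determines an element
from its value at `ω`. -/
theorem fibre_eq_smul_areaPow {s : ℝ} {x : M} (φ : Fibre J s x) :
    φ = φ.1 (metricArea hJ x) • areaPow g J s x := by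
  ext η
  rw [φ.2 (metricArea hJ x) η _ (areaRatio_pos η) (eq_areaRatio_smul hJ η)]
  simp [areaPow_apply, mul_comm]

include hJ in
theorem areaPow_ne_zero (s : ℝ) (x : M) : areaPow g J s x ≠ 0 := fun h ↦ by
  have h1 := areaPow_metricArea hJ s x
  rw [h] at h1
  simp at h1

include hJ in
theorem smul_areaPow_injective {s : ℝ} {x : M} {a b : ℂ}
    (h : a • areaPow g J s x = b • areaPow g J s x) : a = b := by
  by_contra hab
  exact smul_ne_zero (sub_ne_zero.2 hab) (areaPow_ne_zero hJ s x) (by rw [sub_smul, h, sub_self])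

include hJ in
theorem contMDiff_areaPow (s : ℝ) (η : AreaForm J) :
    ContMDiff (𝓡 2) 𝓘(ℝ, ℝ) ∞ (fun x ↦ areaRatio g (η.toFun x) ^ s) := by
  intro x
  exact ContMDiffAt.comp (g := fun t : ℝ ↦ t ^ s) x
    (Real.contDiffAt_rpow_const_of_ne (areaRatio_pos _).ne').contMDiffAt (contMDiff_areaRatio hJ η x)

omit [IsManifold (𝓡 2) ∞ M] [T2Space M] in
theorem contMDiff_ofReal {f : M → ℝ} (hf : ContMDiff (𝓡 2) 𝓘(ℝ, ℝ) ∞ f) :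
    ContMDiff (𝓡 2) 𝓘(ℝ, ℂ) ∞ (fun x ↦ (f x : ℂ)) :=
  Complex.ofRealCLM.contDiff.contMDiff.comp hf

omit [IsManifold (𝓡 2) ∞ M] [T2Space M] in
theorem contMDiff_mul {f f' : M → ℂ} (hf : ContMDiff (𝓡 2) 𝓘(ℝ, ℂ) ∞ f)
    (hf' : ContMDiff (𝓡 2) 𝓘(ℝ, ℂ) ∞ f') : ContMDiff (𝓡 2) 𝓘(ℝ, ℂ) ∞ (fun x ↦ f x * f' x) :=
  (contDiff_mul (𝕜 := ℝ) (𝔸 := ℂ)).contMDiff.comp (hf.prodMk_space hf')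

/-- The smooth section `η ↦ (η / ω)^s`, `ω` being the area form of the metric. -/
def areaPowSection (s : ℝ) : LSection J s where
  toFun := areaPow g J s
  smooth η := contMDiff_ofReal (contMDiff_areaPow hJ s η)

/-- The coefficient of a section with respect to `areaPow`. -/
def coeff {s : ℝ} (σ : LSection J s) : CFun M :=
  ⟨fun x ↦ (σ.toFun x).1 (metricArea hJ x), σ.smooth (metricAreaForm hJ)⟩

theorem toFun_eq_coeff_smul {s : ℝ} (σ : LSection J s) (x : M) :
    σ.toFun x = coeff hJ σ x • areaPow g J s x := fibre_eq_smul_areaPow hJ _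

theorem eq_coeff_smul {s : ℝ} (σ : LSection J s) : σ = coeff hJ σ • areaPowSection hJ s :=
  LSection.ext (funext fun x ↦ toFun_eq_coeff_smul hJ σ x)

omit [T2Space M] in
theorem coeff_smul {s : ℝ} (f : CFun M) (σ : LSection J s) (x : M) :
    coeff hJ (f • σ) x = f x * coeff hJ σ x := rfl

/-! ### The operator `∂̄` of a 1-form -/

omit [IsManifold (𝓡 2) ∞ M] [T2Space M] in
theorem mvfderiv_mul_complex {f f' : M → ℂ} {x : M}
    (hf : MDifferentiableAt (𝓡 2) 𝓘(ℝ, ℂ) f x) (hf' : MDifferentiableAt (𝓡 2) 𝓘(ℝ, ℂ) f' x)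
    (v : TangentSpace (𝓡 2) x) :
    mvfderiv (𝓡 2) (fun y ↦ f y * f' y) x v =
      f x * mvfderiv (𝓡 2) f' x v + f' x * mvfderiv (𝓡 2) f x v := by
  have h := (hf.hasMFDerivAt.mul hf'.hasMFDerivAt).mfderiv
  simp only [mvfderiv, ContinuousLinearMap.comp_apply]
  change mfderiv (𝓡 2) 𝓘(ℝ, ℂ) (f * f') x v = _
  rw [h]
  rfl

omit [IsManifold (𝓡 2) ∞ M] [T2Space M] in
theorem mdifferentiableAt_cFun (f : CFun M) (x : M) : MDifferentiableAt (𝓡 2) 𝓘(ℝ, ℂ) f x :=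
  f.contMDiff.mdifferentiable (by simp) x

omit [T2Space M] in
theorem dbarFun_add {f f' : M → ℂ} {x : M}
    (hf : MDifferentiableAt (𝓡 2) 𝓘(ℝ, ℂ) f x) (hf' : MDifferentiableAt (𝓡 2) 𝓘(ℝ, ℂ) f' x)
    (v : TangentSpace (𝓡 2) x) :
    dbarFun J (fun y ↦ f y + f' y) x v = dbarFun J f x v + dbarFun J f' x v := by
  simp only [dbarFun, mvfderiv_fun_add hf hf', add_apply]
  ring

omit [T2Space M] in
theorem dbarFun_mul {f f' : M → ℂ} {x : M}
    (hf : MDifferentiableAt (𝓡 2) 𝓘(ℝ, ℂ) f x) (hf' : MDifferentiableAt (𝓡 2) 𝓘(ℝ, ℂ) f' x)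
    (v : TangentSpace (𝓡 2) x) :
    dbarFun J (fun y ↦ f y * f' y) x v = f x * dbarFun J f' x v + f' x * dbarFun J f x v := by
  simp only [dbarFun, mvfderiv_mul_complex hf hf']
  ring

omit [T2Space M] in
theorem contMDiff_dbarFun (f : CFun M) (X : VField M) :
    ContMDiff (𝓡 2) 𝓘(ℝ, ℂ) ∞ (fun x ↦ dbarFun J f x (X x)) :=
  contMDiff_mul contMDiff_const ((contMDiff_mvfderiv_apply f.contMDiff X).add
    (contMDiff_mul contMDiff_const (contMDiff_mvfderiv_apply f.contMDiff (J.mapField X))))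

/-- The `(0,1)`-form `-s (θ + i θ ∘ J)`. -/
def connForm01 (J : ComplexStr M) (s : ℝ) (θ : OneForm M) (x : M) (v : TangentSpace (𝓡 2) x) : ℂ :=
  -s * (θ.toFun x v + Complex.I * θ.toFun x (J.toFun x v))

omit [T2Space M] in
theorem connForm01_J (s : ℝ) (θ : OneForm M) (x : M) (v : TangentSpace (𝓡 2) x) :
    connForm01 J s θ x (J.toFun x v) = -(Complex.I * connForm01 J s θ x v) := by
  simp only [connForm01, J.sq, map_neg, Complex.ofReal_neg]
  linear_combination (-s * θ.toFun x (J.toFun x v) : ℂ) * Complex.I_mul_I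

omit [T2Space M] in
theorem contMDiff_connForm01 (s : ℝ) (θ : OneForm M) (X : VField M) :
    ContMDiff (𝓡 2) 𝓘(ℝ, ℂ) ∞ (fun x ↦ connForm01 J s θ x (X x)) :=
  contMDiff_mul contMDiff_const ((contMDiff_ofReal (θ.smooth X)).add
    (contMDiff_mul contMDiff_const (contMDiff_ofReal (θ.smooth (J.mapField X)))))

/-- The coefficient `∂̄f - s (θ + i θ ∘ J) f` of `∂̄ (f σ₀)`. -/
def dbarCoeff (J : ComplexStr M) (s : ℝ) (θ : OneForm M) (f : M → ℂ) (x : M)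
    (v : TangentSpace (𝓡 2) x) : ℂ :=
  dbarFun J f x v + connForm01 J s θ x v * f x

/-- The `(0,1)`-form `∂̄ (f σ₀) = (∂̄f - s (θ + i θ ∘ J) f) σ₀`. -/
def dbarOf (s : ℝ) (θ : OneForm M) (σ : LSection J s) : LForm01 J s where
  toFun x :=
    { toFun := fun v ↦ dbarCoeff J s θ (coeff hJ σ) x v • areaPow g J s x
      map_add' := fun v w ↦ by
        rw [← add_smul]
        congr 1
        simp only [dbarCoeff, dbarFun, connForm01, map_add, Complex.ofReal_add]
        ring
      map_smul' := fun c v ↦ by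
        rw [RingHom.id_apply, ← smul_assoc]
        congr 1
        simp only [dbarCoeff, dbarFun, connForm01, map_smul, Complex.real_smul, smul_eq_mul,
          Complex.ofReal_mul]
        ring }
  type01 x v := by
    change dbarCoeff J s θ (coeff hJ σ) x (J.toFun x v) • areaPow g J s x =
      -(Complex.I • dbarCoeff J s θ (coeff hJ σ) x v • areaPow g J s x)
    rw [← smul_assoc]
    refine Eq.trans ?_ (neg_smul _ _)
    congr 1
    simp only [dbarCoeff, connForm01_J, dbarFun, J.sq, map_neg, smul_eq_mul]
    linear_combination (1 / 2 * mvfderiv (𝓡 2) (coeff hJ σ) x (J.toFun x v)) * Complex.I_mul_I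
  smooth X η := contMDiff_mul ((contMDiff_dbarFun (coeff hJ σ) X).add
    (contMDiff_mul (contMDiff_connForm01 s θ X) (coeff hJ σ).contMDiff))
    (contMDiff_ofReal (contMDiff_areaPow hJ s η))

theorem dbarOf_apply (s : ℝ) (θ : OneForm M) (σ : LSection J s) (x : M)
    (v : TangentSpace (𝓡 2) x) :
    (dbarOf hJ s θ σ).toFun x v = dbarCoeff J s θ (coeff hJ σ) x v • areaPow g J s x := rfl

theorem dbarOf_add (s : ℝ) (θ : OneForm M) (σ τ : LSection J s) (x : M) :
    (dbarOf hJ s θ (σ + τ)).toFun x = (dbarOf hJ s θ σ).toFun x + (dbarOf hJ s θ τ).toFun x := by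
  ext1 v
  rw [LinearMap.add_apply, dbarOf_apply, dbarOf_apply, dbarOf_apply, ← add_smul]
  congr 1
  have := dbarFun_add (J := J) (mdifferentiableAt_cFun (coeff hJ σ) x)
    (mdifferentiableAt_cFun (coeff hJ τ) x) v
  change dbarFun J (fun y ↦ coeff hJ σ y + coeff hJ τ y) x v +
    connForm01 J s θ x v * (coeff hJ σ x + coeff hJ τ x) = _
  rw [this]
  simp only [dbarCoeff]
  ring

theorem dbarOf_smul (s : ℝ) (θ : OneForm M) (f : CFun M) (σ : LSection J s) (x : M)
    (v : TangentSpace (𝓡 2) x) : (dbarOf hJ s θ (f • σ)).toFun x v =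
      f x • (dbarOf hJ s θ σ).toFun x v + dbarFun J f x v • σ.toFun x := by
  rw [toFun_eq_coeff_smul hJ σ, dbarOf_apply, dbarOf_apply, ← smul_assoc, ← smul_assoc, ← add_smul]
  congr 1
  have := dbarFun_mul (J := J) (mdifferentiableAt_cFun f x)
    (mdifferentiableAt_cFun (coeff hJ σ) x) v
  change dbarFun J (fun y ↦ f y * coeff hJ σ y) x v +
    connForm01 J s θ x v * (f x * coeff hJ σ x) = _
  rw [this]
  simp only [dbarCoeff, smul_eq_mul]
  ring

include hJ in
/-- Every holomorphic structure comes from a 1-form. -/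
theorem HolStructure.exists_eq_dbarOf {s : ℝ} (hs : s ≠ 0) (H : HolStructure J s) :
    ∃ θ : OneForm M, ∀ σ, H.dbar σ = dbarOf hJ s θ σ := by
  let a (x : M) (v : TangentSpace (𝓡 2) x) : ℂ :=
    ((H.dbar (areaPowSection hJ s)).toFun x v).1 (metricArea hJ x)
  have ha (x : M) (v) : (H.dbar (areaPowSection hJ s)).toFun x v = a x v • areaPow g J s x :=
    fibre_eq_smul_areaPow hJ _
  have haJ (x : M) (v) : a x (J.toFun x v) = -(Complex.I * a x v) := by
    change ((H.dbar (areaPowSection hJ s)).toFun x (J.toFun x v)).1 (metricArea hJ x) = _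
    rw [(H.dbar (areaPowSection hJ s)).type01]
    rfl
  have hfin (x : M) : FiniteDimensional ℝ (TangentSpace (𝓡 2) x) :=
    inferInstanceAs (FiniteDimensional ℝ Plane)
  have hT2 (x : M) : T2Space (TangentSpace (𝓡 2) x) := inferInstanceAs (T2Space Plane)
  let θ : OneForm M :=
    { toFun := fun x ↦ LinearMap.toContinuousLinearMap
        -- Since `a` has type (0,1), `Im a(v) = Re a(J v)`: the real part carries all of `a`, and
        -- dividing by `-s` undoes the factor in `connForm01`.
        { toFun := fun v ↦ -(a x v).re / s
          map_add' := fun v w ↦ by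
            have : a x (v + w) = a x v + a x w := by simp [a]
            rw [this, Complex.add_re]; ring
          map_smul' := fun c v ↦ by
            have : a x (c • v) = c • a x v := by simp [a]
            rw [this, Complex.smul_re, RingHom.id_apply, smul_eq_mul, smul_eq_mul]; ring }
      smooth := fun X ↦ by
        have h1 := (H.dbar (areaPowSection hJ s)).smooth X (metricAreaForm hJ)
        have h2 : ContMDiff (𝓡 2) 𝓘(ℝ, ℝ) ∞ (fun x ↦ (a x (X x)).re) :=
          Complex.reCLM.contDiff.contMDiff.comp h1
        exact (contDiff_neg.div_const s).contMDiff.comp h2 }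
  have hθ (x : M) (v : TangentSpace (𝓡 2) x) : θ.toFun x v = -(a x v).re / s := rfl
  have haθ (x : M) (v : TangentSpace (𝓡 2) x) : connForm01 J s θ x v = a x v := by
    have hsC : (s : ℂ) ≠ 0 := by exact_mod_cast hs
    rw [connForm01, hθ, hθ, haJ]
    simp only [Complex.neg_re, Complex.mul_re, Complex.I_re, Complex.I_im]
    conv_rhs => rw [← Complex.re_add_im (a x v)]
    push_cast
    field_simp
    ring
  refine ⟨θ, fun σ ↦ LForm01.ext (funext fun x ↦ LinearMap.ext fun v ↦ ?_)⟩
  rw [dbarOf_apply]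
  conv_lhs => rw [eq_coeff_smul hJ σ]
  rw [H.leibniz, ha, ← smul_assoc]
  change _ + dbarFun J (coeff hJ σ) x v • areaPow g J s x = _
  rw [← add_smul, dbarCoeff, haθ, smul_eq_mul]
  congr 1
  ring

/-- The coefficient of `∂̄ σ₀` has real part `-s θ`. -/
theorem dbarOf_injective {s : ℝ} (hs : s ≠ 0) {θ θ' : OneForm M}
    (h : ∀ σ, dbarOf hJ s θ σ = dbarOf hJ s θ' σ) : θ = θ' := by
  refine OneForm.ext' fun x v ↦ ?_
  have h1 : (dbarOf hJ s θ (areaPowSection hJ s)).toFun x v =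
    (dbarOf hJ s θ' (areaPowSection hJ s)).toFun x v := by rw [h]
  have h2 := smul_areaPow_injective hJ h1
  have hc : coeff hJ (areaPowSection hJ s) x = 1 := areaPow_metricArea hJ s x
  simp only [dbarCoeff, hc, mul_one, add_right_inj, connForm01] at h2
  have h3 := congrArg Complex.re h2
  simpa [hs] using h3

/-! ### The induced connection -/

omit [T2Space M] in
include hJ in
/-- A conformal connection is complex linear. -/
theorem NablaMetricEq.conn_mapField
    {D : CovariantDerivative (𝓡 2) Plane (TangentSpace (𝓡 2) : M → Type)} {θ : OneForm M}
    [T2Space M] (hD : NablaMetricEq D g θ) (X : VField M) (x : M) (v : TangentSpace (𝓡 2) x) :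
    D (J.mapField X) x v = J.toFun x (D X x v) := by
  -- When `X x ≠ 0`, test the difference against the basis `X, J X`: differentiating `g(X, J X) = 0`
  -- gives one component, comparing the equations for `g(X, X) = g(J X, J X)` the other.
  have main : ∀ X : VField M, X x ≠ 0 → D (J.mapField X) x v = J.toFun x (D X x v) := by
    intro X hX
    have k1 : g.inner x (D (J.mapField X) x v) (X x) =
        g.inner x (J.toFun x (D X x v)) (X x) := by
      have := hD X (J.mapField X) x v
      rw [mvfderiv_eq_zero_of_eventually_const (c := 0)
        (by filter_upwards with y; simp [inner_J_self hJ])] at this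
      simp only [zero_apply, J.mapField_apply, inner_J_self hJ] at this
      rw [g.symm, inner_J_left hJ]
      linarith
    have k2 : g.inner x (D (J.mapField X) x v) (J.toFun x (X x)) =
        g.inner x (J.toFun x (D X x v)) (J.toFun x (X x)) := by
      have h1 := hD X X x v
      have h2 := hD (J.mapField X) (J.mapField X) x v
      simp only [J.mapField_apply, hJ] at h2
      rw [g.symm x (X x)] at h1
      rw [g.symm x (J.toFun x (X x))] at h2
      rw [hJ]
      linarith
    have hz : g.inner x (D (J.mapField X) x v - J.toFun x (D X x v))
        (D (J.mapField X) x v - J.toFun x (D X x v)) = 0 := by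
      obtain ⟨a, b, hab⟩ := J.exists_eq_add hX (D (J.mapField X) x v - J.toFun x (D X x v))
      conv_lhs => rw [hab, map_add, map_smul, map_smul, ← hab]
      simp [k1, k2]
    by_contra hne
    exact (g.pos x _ (sub_ne_zero.2 hne)).ne' hz
  by_cases hX : X x = 0
  -- If `X` vanishes at `x`, apply the previous case to `X + E` and to `E`, and subtract.
  · set E := unitField g x with hE
    have hE0 := unitField_ne_zero g x
    have h1 := main (X + E) (by simpa [hX] using hE0)
    have h2 := main E hE0
    have e1 : D (J.mapField (X + E)) x = D (J.mapField X) x + D (J.mapField E) x := by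
      rw [← D.isCovariantDerivativeOnUniv.add (mdifferentiableAt_vField (J.mapField X) x)
        (mdifferentiableAt_vField (J.mapField E) x)]
      congr 1
      funext y
      simp
    have e2 : D ⇑(X + E) x = D X x + D E x := by
      rw [← D.isCovariantDerivativeOnUniv.add (mdifferentiableAt_vField X x)
        (mdifferentiableAt_vField E x)]
      rfl
    rw [e1, e2, add_apply, add_apply, map_add, h2] at h1
    exact add_right_cancel h1
  · exact main X hX

omit [T2Space M] in
include hJ in
-- Because `ω = g(J ·, ·)` and `∇` commutes with `J`, the equation for `g` applied to `J X, Y` is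
-- `∇ω = 2 θ ⊗ ω`.
theorem NablaMetricEq.nablaMetricAreaForm [T2Space M]
    {D : CovariantDerivative (𝓡 2) Plane (TangentSpace (𝓡 2) : M → Type)} {θ : OneForm M}
    (hD : NablaMetricEq D g θ) (X Y : VField M) (x : M) (v : TangentSpace (𝓡 2) x) :
    mvfderiv (𝓡 2) (fun y ↦ g.inner y (J.toFun y (X y)) (Y y)) x v
      - g.inner x (J.toFun x (D X x v)) (Y x) - g.inner x (J.toFun x (X x)) (D Y x v)
      = 2 * θ.toFun x v * g.inner x (J.toFun x (X x)) (Y x) := by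
  have := hD (J.mapField X) Y x v
  rw [hD.conn_mapField hJ] at this
  exact this

include hJ in
/-- `∇η = (dc + 2 c θ) ⊗ ω` for `η = c ω`, if `∇ g = 2 θ ⊗ g`. -/
theorem NablaMetricEq.nablaForm_eq
    {D : CovariantDerivative (𝓡 2) Plane (TangentSpace (𝓡 2) : M → Type)} {θ : OneForm M}
    (hD : NablaMetricEq D g θ) (η : AreaForm J) (X Y : VField M) (x : M)
    (v : TangentSpace (𝓡 2) x) :
    nablaForm D η X Y x v =
      (mvfderiv (𝓡 2) (fun y ↦ areaRatio g (η.toFun y)) x v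
        + 2 * areaRatio g (η.toFun x) * θ.toFun x v) * g.inner x (J.toFun x (X x)) (Y x) := by
  have h1 := hD.nablaMetricAreaForm hJ X Y x v
  have hc : MDifferentiableAt (𝓡 2) 𝓘(ℝ, ℝ) (fun y ↦ areaRatio g (η.toFun y)) x :=
    (contMDiff_areaRatio hJ η).mdifferentiable (by simp) x
  have hω := g.mdifferentiableAt_inner (mdifferentiableAt_vField (J.mapField X) x)
    (mdifferentiableAt_vField Y x)
  have h2 := mvfderiv_fun_mul hc hω
  simp only [J.mapField_apply] at h2
  simp only [nablaForm, apply_eq_areaRatio_mul hJ]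
  rw [h2]
  simp only [add_apply, smul_apply, smul_eq_mul]
  linear_combination areaRatio g (η.toFun x) * h1

/-- The connection `∇ (f σ₀) = (df - 2 s θ f) σ₀`. -/
def connOf (s : ℝ) (θ : OneForm M) (σ : LSection J s) (x : M) :
    TangentSpace (𝓡 2) x →ₗ[ℝ] Fibre J s x where
  toFun v := (mvfderiv (𝓡 2) (coeff hJ σ) x v - 2 * s * θ.toFun x v * coeff hJ σ x) •
    areaPow g J s x
  map_add' v w := by
    rw [← add_smul]
    congr 1
    simp only [map_add, Complex.ofReal_add]
    ring
  map_smul' c v := by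
    rw [RingHom.id_apply, ← smul_assoc]
    congr 1
    simp only [map_smul, Complex.real_smul, smul_eq_mul, Complex.ofReal_mul]
    ring

theorem connOf_apply (s : ℝ) (θ : OneForm M) (σ : LSection J s) (x : M)
    (v : TangentSpace (𝓡 2) x) : connOf hJ s θ σ x v =
      (mvfderiv (𝓡 2) (coeff hJ σ) x v - 2 * s * θ.toFun x v * coeff hJ σ x) •
        areaPow g J s x := rfl

theorem dbarOf_eq_connOf (s : ℝ) (θ : OneForm M) (σ : LSection J s) (x : M)
    (v : TangentSpace (𝓡 2) x) : (dbarOf hJ s θ σ).toFun x v =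
      (1 / 2 : ℂ) • (connOf hJ s θ σ x v + Complex.I • connOf hJ s θ σ x (J.toFun x v)) := by
  rw [dbarOf_apply, connOf_apply, connOf_apply, ← smul_assoc, ← add_smul, ← smul_assoc]
  congr 1
  simp only [dbarCoeff, dbarFun, connForm01, smul_eq_mul]
  ring

/-- Write `η = c ω` and `σ = f σ₀`, so `σ(η) = c^s f`. The `dc` term from differentiating `c^s`
cancels the one in `∇η`, and what remains is `df - 2 s θ f`. -/
theorem isInducedConnection_connOf (s : ℝ) {θ : OneForm M}
    {D : CovariantDerivative (𝓡 2) Plane (TangentSpace (𝓡 2) : M → Type)}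
    (hD : NablaMetricEq D g θ) : IsInducedConnection D (connOf hJ s θ) := by
  intro σ η X Y x v
  set f := coeff hJ σ with hf
  set c : M → ℝ := fun y ↦ areaRatio g (η.toFun y) with hcdef
  have hcpos : 0 < c x := areaRatio_pos _
  have hc : MDifferentiableAt (𝓡 2) 𝓘(ℝ, ℝ) c x :=
    (contMDiff_areaRatio hJ η).mdifferentiable (by simp) x
  have hcs : MDifferentiableAt (𝓡 2) 𝓘(ℝ, ℝ) (fun y ↦ c y ^ s) x :=
    (contMDiff_areaPow hJ s η).mdifferentiable (by simp) x
  have hση : (fun y ↦ (σ.toFun y).1 (η.toFun y)) = fun y ↦ (c y ^ s) • f y := by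
    funext y
    rw [toFun_eq_coeff_smul hJ σ y]
    change coeff hJ σ y * ((c y ^ s : ℝ) : ℂ) = _
    rw [Complex.real_smul, mul_comm]
  have hd : HasDerivAt (fun t : ℝ ↦ t ^ s) (s * c x ^ (s - 1)) (c x) :=
    Real.hasDerivAt_rpow_const (Or.inl hcpos.ne')
  have hdc : mvfderiv (𝓡 2) (fun y ↦ c y ^ s) x v =
      s * c x ^ (s - 1) * mvfderiv (𝓡 2) c x v := by
    rw [mvfderiv_comp_eq_fderiv (φ := fun t : ℝ ↦ t ^ s) hd.differentiableAt hc v,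
      hd.hasFDerivAt.fderiv]
    simp [mul_comm]
  have hpow : c x ^ s = c x * c x ^ (s - 1) := by
    rw [Real.rpow_sub_one hcpos.ne']
    field_simp
  have hDL : (connOf hJ s θ σ x v).1 (η.toFun x) =
      (mvfderiv (𝓡 2) f x v - 2 * s * θ.toFun x v * f x) * ((c x ^ s : ℝ) : ℂ) := rfl
  rw [hση, hDL, hD.nablaForm_eq hJ, apply_eq_areaRatio_mul hJ,
    mvfderiv_fun_smul hcs (mdifferentiableAt_cFun f x), congrFun hση x]
  have hcx : areaRatio g (η.toFun x) = c x := rfl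
  simp only [add_apply, smul_apply, ContinuousLinearMap.smulRight_apply, hdc, hpow,
    Complex.real_smul, hcx, ← hcdef]
  push_cast
  ring

end Area

section Holomorphic

/-! ### The `∂̄`-equation on a surface -/

theorem exists_contDiff_eventuallyEq {c : ℂ → ℂ} {q : ℂ} (h : ∀ᶠ p in 𝓝 q, ContDiffAt ℝ ∞ c p) :
    ∃ b : ℂ → ℂ, ContDiff ℝ ∞ b ∧ HasCompactSupport b ∧ ∀ᶠ p in 𝓝 q, b p = c p := by
  obtain ⟨ε, hε, hball⟩ := Metric.eventually_nhds_iff_ball.1 h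
  let χ : ContDiffBump q := ⟨ε / 4, ε / 2, by positivity, by linarith⟩
  refine ⟨fun p ↦ χ p • c p, contDiff_iff_contDiffAt.2 fun p ↦ ?_, χ.hasCompactSupport.smul_right,
    ?_⟩
  · by_cases hp : p ∈ Metric.ball q ε
    · exact χ.contDiffAt.smul (hball p hp)
    · have hp' : p ∉ tsupport χ := by
        rw [χ.tsupport_eq]
        intro hmem
        exact hp (Metric.closedBall_subset_ball (by change ε / 2 < ε; linarith) hmem)
      have h0 : (fun p ↦ χ p • c p) =ᶠ[𝓝 p] fun _ ↦ 0 := by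
        filter_upwards [(isClosed_tsupport χ).isOpen_compl.mem_nhds hp'] with y hy
        rw [image_eq_zero_of_notMem_tsupport hy, zero_smul]
      exact contDiffAt_const.congr_of_eventuallyEq h0
  · filter_upwards [χ.eventuallyEq_one] with p hp
    rw [hp, Pi.one_apply, one_smul]

/-- Near a point with invertible derivative a smooth function factors through the map. -/
theorem exists_contDiff_comp_eq {f B : Plane → ℂ} {p : Plane} {e : Plane ≃L[ℝ] ℂ}
    (hf : ∀ᶠ y in 𝓝 p, ContDiffAt ℝ ∞ f y) (hB : ∀ᶠ y in 𝓝 p, ContDiffAt ℝ ∞ B y)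
    (he : fderiv ℝ f p = e) :
    ∃ b : ℂ → ℂ, ContDiff ℝ ∞ b ∧ HasCompactSupport b ∧ ∀ᶠ y in 𝓝 p, b (f y) = B y := by
  have hfp := hf.self_of_nhds
  have hfd : HasFDerivAt f (e : Plane →L[ℝ] ℂ) p :=
    he ▸ (hfp.differentiableAt (by simp)).hasFDerivAt
  set h := hfp.toOpenPartialHomeomorph f hfd (by simp) with hh
  have hcoe : ⇑h = f := hfp.toOpenPartialHomeomorph_coe hfd (by simp)
  have hps : p ∈ h.source := hfp.mem_toOpenPartialHomeomorph_source hfd (by simp)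
  have hpt : f p ∈ h.target := by rw [← hcoe]; exact h.map_source hps
  have hsymm : h.symm (f p) = p := by rw [← hcoe]; exact h.left_inv hps
  have hcont : Filter.Tendsto h.symm (𝓝 (f p)) (𝓝 p) := by
    have := (h.continuousAt_symm hpt).tendsto
    rwa [hsymm] at this
  -- The inverse must be smooth on a neighbourhood, not just at `f p`; openness of the invertible
  -- maps keeps the derivative invertible nearby.
  have hequiv : ∀ᶠ y in 𝓝 p, ∃ e' : Plane ≃L[ℝ] ℂ, (e' : Plane →L[ℝ] ℂ) = fderiv ℝ f y := by
    have hc : ContinuousAt (fderiv ℝ f) p :=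
      (hfp.fderiv_right (m := 0) (by simp)).continuousAt
    have hn := ContinuousLinearEquiv.nhds e
    rw [← he] at hn
    exact hc hn
  have hc : ∀ᶠ q in 𝓝 (f p), ContDiffAt ℝ ∞ (fun q ↦ B (h.symm q)) q := by
    filter_upwards [hcont.eventually hequiv, hcont.eventually hf, hcont.eventually hB,
      h.open_target.mem_nhds hpt] with q ⟨e', he'⟩ hfq hBq hqt
    have hd : HasFDerivAt h (e' : Plane →L[ℝ] ℂ) (h.symm q) := by
      rw [hcoe, he']; exact (hfq.differentiableAt (by simp)).hasFDerivAt
    exact hBq.comp q (h.contDiffAt_symm hqt hd (by rw [hcoe]; exact hfq))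
  obtain ⟨b, hb, hbc, hbe⟩ := exists_contDiff_eventuallyEq hc
  refine ⟨b, hb, hbc, ?_⟩
  filter_upwards [hfp.continuousAt.eventually hbe, h.open_source.mem_nhds hps] with y hy hys
  rw [hy]
  congr 1
  rw [← hcoe]
  exact h.left_inv hys

omit [IsManifold (𝓡 2) ∞ M] in
theorem fderiv_chart_eq_mvfderiv {f : M → ℂ} {x : M}
    (hf : MDifferentiableAt (𝓡 2) 𝓘(ℝ, ℂ) f x) :
    fderiv ℝ (fun p ↦ f ((extChartAt (𝓡 2) x).symm p)) (extChartAt (𝓡 2) x x) =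
      mvfderiv (𝓡 2) f x := by
  rw [hf.mvfderiv, ModelWithCorners.range_eq_univ, fderivWithin_univ]
  rfl

theorem eventually_contDiffAt_chart {f : M → ℂ} (hf : ContMDiff (𝓡 2) 𝓘(ℝ, ℂ) ∞ f) (x : M) :
    ∀ᶠ p in 𝓝 (extChartAt (𝓡 2) x x),
      ContDiffAt ℝ ∞ (fun p ↦ f ((extChartAt (𝓡 2) x).symm p)) p := by
  filter_upwards [(isOpen_extChartAt_target (I := 𝓡 2) x).mem_nhds (mem_extChartAt_target x)]
    with p hp
  have h1 := (contMDiffOn_extChartAt_symm (I := 𝓡 2) (n := ∞) x p hp).contMDiffAt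
    ((isOpen_extChartAt_target (I := 𝓡 2) x).mem_nhds hp)
  exact (hf.contMDiffAt.comp p h1).contDiffAt

/-- Near a point where `dz` is invertible every smooth function is a smooth function of `z`. -/
theorem exists_contDiff_comp_coordinate {z β : CFun M} {x : M}
    (hz : Function.Injective (mvfderiv (𝓡 2) z x)) :
    ∃ b : ℂ → ℂ, ContDiff ℝ ∞ b ∧ HasCompactSupport b ∧ ∀ᶠ y in 𝓝 x, b (z y) = β y := by
  let L : Plane →ₗ[ℝ] ℂ := (mvfderiv (𝓡 2) z x).toLinearMap
  let e : Plane ≃L[ℝ] ℂ := (LinearEquiv.ofInjectiveOfFinrankEq L hz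
    (by rw [finrank_euclideanSpace_fin, Complex.finrank_real_complex])).toContinuousLinearEquiv
  obtain ⟨b, hb, hbc, hbe⟩ := exists_contDiff_comp_eq (e := e)
    (eventually_contDiffAt_chart z.contMDiff x) (eventually_contDiffAt_chart β.contMDiff x)
    (by rw [fderiv_chart_eq_mvfderiv (mdifferentiableAt_cFun z x)]; ext v; rfl)
  refine ⟨b, hb, hbc, ?_⟩
  filter_upwards [(continuousAt_extChartAt (I := 𝓡 2) x).eventually hbe,
    extChartAt_source_mem_nhds (I := 𝓡 2) x] with y hy hys
  rwa [(extChartAt (𝓡 2) x).left_inv hys] at hy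

variable [T2Space M] {g : Metric M} {J : ComplexStr M}

omit [T2Space M] in
theorem mvfderiv_J_of_dbarFun_eq_zero {z : M → ℂ} {x : M} {v : TangentSpace (𝓡 2) x}
    (h : dbarFun J z x v = 0) :
    mvfderiv (𝓡 2) z x (J.toFun x v) = Complex.I * mvfderiv (𝓡 2) z x v := by
  have h1 : mvfderiv (𝓡 2) z x v + Complex.I * mvfderiv (𝓡 2) z x (J.toFun x v) = 0 := by
    simpa [dbarFun] using h
  linear_combination (-Complex.I) * h1 + mvfderiv (𝓡 2) z x (J.toFun x v) * Complex.I_mul_I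

omit [T2Space M] in
-- This is the chain rule `∂̄(U ∘ z) = (∂U/∂z̄)(z) conj (dz)`: holomorphy of `z` makes `dz` complex
-- linear.
theorem dbarFun_comp {U : ℂ → ℂ} (hU : ContDiff ℝ ∞ U) {z : CFun M} {x : M}
    {v : TangentSpace (𝓡 2) x} (h : dbarFun J z x v = 0) :
    dbarFun J (fun y ↦ U (z y)) x v = (starRingEnd ℂ) (mvfderiv (𝓡 2) z x v) *
      ((1 / 2 : ℂ) * (fderiv ℝ U (z x) 1 + Complex.I * fderiv ℝ U (z x) Complex.I)) := by
  have hUd := hU.differentiable (by simp) (z x)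
  have hzd := mdifferentiableAt_cFun z x
  rw [dbarFun, mvfderiv_comp_eq_fderiv hUd hzd, mvfderiv_comp_eq_fderiv hUd hzd,
    mvfderiv_J_of_dbarFun_eq_zero h, ← conj_mul_apply_add]
  ring

/-- The `∂̄`-equation has local solutions. -/
theorem exists_dbarFun_eq (g : Metric M) (s : ℝ) (θ : OneForm M) {z : M → ℂ} {x : M}
    (hz : IsHolCoordAt J z x) :
    ∃ u : CFun M, ∀ᶠ y in 𝓝 x, ∀ v : TangentSpace (𝓡 2) y,
      dbarFun J u y v = connForm01 J s θ y v := by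
  obtain ⟨hz1, hz2⟩ := hz
  obtain ⟨z', hz'⟩ := exists_contMDiffMap_eventuallyEq (hz1.mono fun y hy ↦ hy.1)
  have hol : ∀ᶠ y in 𝓝 x, ∀ v : TangentSpace (𝓡 2) y, dbarFun J z' y v = 0 := by
    filter_upwards [hz1, hz'.eventually_nhds] with y hy hzy v
    rw [dbarFun, eventuallyEq_mvfderiv hzy]
    exact hy.2 v
  rw [← eventuallyEq_mvfderiv hz'] at hz2
  set E := unitField g x with hE
  have hE0 := unitField_ne_zero g x
  -- A complex linear map vanishing on some `v ≠ 0` vanishes on `J v` too, hence everywhere,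
  -- contrary to `dz ≠ 0`.
  have hinj : Function.Injective (mvfderiv (𝓡 2) z' x) := by
    rw [injective_iff_map_eq_zero]
    intro v hv
    by_contra hv0
    apply hz2
    ext w
    obtain ⟨a, b, rfl⟩ := J.exists_eq_add hv0 w
    simp [hv, mvfderiv_J_of_dbarFun_eq_zero (hol.self_of_nhds v)]
  have hdzE : ContMDiff (𝓡 2) 𝓘(ℝ, ℂ) ∞ (fun y ↦ mvfderiv (𝓡 2) z' y (E y)) :=
    contMDiff_mvfderiv_apply z'.contMDiff E
  have hne : ∀ᶠ y in 𝓝 x, mvfderiv (𝓡 2) z' y (E y) ≠ 0 :=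
    hdzE.continuous.continuousAt.eventually_ne fun h ↦ hE0 (hinj (by rw [h, map_zero]))
  -- `β` is the coefficient of the given (0,1)-form relative to `conj (dz)`, read off on `E`.
  -- Written as `b ∘ z`, it reduces the problem to `∂U/∂z̄ = b` in the plane.
  obtain ⟨β, hβ⟩ := exists_contMDiffMap_eventuallyEq (x := x)
    (f := fun y ↦ connForm01 J s θ y (E y) *
      ((starRingEnd ℂ) (mvfderiv (𝓡 2) z' y (E y)))⁻¹) (by
      filter_upwards [hne] with y hy
      have h1 : ContDiffAt ℝ ∞ (fun w : ℂ ↦ ((starRingEnd ℂ) w)⁻¹) (mvfderiv (𝓡 2) z' y (E y)) :=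
        Complex.conjCLE.contDiff.contDiffAt.inv (by simpa using hy)
      have h2 : ContMDiffAt (𝓡 2) 𝓘(ℝ, ℂ) ∞
          (fun y ↦ ((starRingEnd ℂ) (mvfderiv (𝓡 2) z' y (E y)))⁻¹) y :=
        ContMDiffAt.comp (g := fun w : ℂ ↦ ((starRingEnd ℂ) w)⁻¹) y h1.contMDiffAt (hdzE y)
      exact ((contDiff_mul (𝕜 := ℝ) (𝔸 := ℂ)).contMDiff.contMDiffAt).comp y
        ((contMDiff_connForm01 s θ E y).prodMk_space h2))
  obtain ⟨b, hb, hbc, hbe⟩ := exists_contDiff_comp_coordinate (β := β) hinj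
  obtain ⟨U, hU, hUb⟩ := exists_dbar_eq hb hbc
  refine ⟨⟨fun y ↦ U (z' y), hU.contMDiff.comp z'.contMDiff⟩, ?_⟩
  filter_upwards [hol, hne, hβ, hbe, eventually_unitField g x] with y hy hney hβy hby hEy v
  change dbarFun J (fun y ↦ U (z' y)) y v = _
  rw [dbarFun_comp hU (hy v), hUb, hby, hβy]
  -- Both sides have type (0,1), so agreement on `E` propagates to `J E` and to the whole tangent
  -- plane.
  have hEy0 : E y ≠ 0 := fun h ↦ hney (by rw [h, map_zero])
  obtain ⟨c, d, rfl⟩ := J.exists_eq_add hEy0 v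
  have hlin : connForm01 J s θ y (c • E y + d • J.toFun y (E y)) =
      c * connForm01 J s θ y (E y) + d * connForm01 J s θ y (J.toFun y (E y)) := by
    simp only [connForm01, map_add, map_smul, smul_eq_mul]
    push_cast
    ring
  have hne' : (starRingEnd ℂ) (mvfderiv (𝓡 2) z' y (E y)) ≠ 0 := by simpa using hney
  rw [hlin, connForm01_J, map_add, map_smul, map_smul,
    mvfderiv_J_of_dbarFun_eq_zero (hy (E y))]
  simp only [Complex.real_smul, map_add, map_mul, Complex.conj_ofReal, Complex.conj_I]
  field_simp

/-! ### Holomorphic structures parametrized by 1-forms -/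

variable (hJ : ∀ (x : M) (v w : TangentSpace (𝓡 2) x),
    g.inner x (J.toFun x v) (J.toFun x w) = g.inner x v w)

/-- The holomorphic structure of a 1-form. -/
def holOf (s : ℝ) (θ : OneForm M) : HolStructure J s where
  dbar := dbarOf hJ s θ
  add := dbarOf_add hJ s θ
  leibniz := dbarOf_smul hJ s θ
  frame x z hz := by
    obtain ⟨u, hu⟩ := exists_dbarFun_eq g s θ hz
    have hexp : ContDiff ℝ ∞ (fun w : ℂ ↦ Complex.exp (-w)) := by fun_prop
    -- The factor `e^{-u}` is an integrating factor: `∂̄(e^{-u} σ₀) = e^{-u} (a - ∂̄u) σ₀`.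
    let f : CFun M := ⟨fun y ↦ Complex.exp (-u y), hexp.contMDiff.comp u.contMDiff⟩
    have hcoeff (y : M) : coeff hJ (f • areaPowSection hJ s) y = f y := by
      rw [coeff_smul]
      exact (congrArg (f y * ·) (areaPow_metricArea hJ s y)).trans (mul_one _)
    have hfun : (coeff hJ (f • areaPowSection hJ s) : M → ℂ) = f := funext hcoeff
    refine ⟨f • areaPowSection hJ s, ?_, ?_⟩
    · rw [toFun_eq_coeff_smul hJ, hcoeff]
      exact smul_ne_zero (Complex.exp_ne_zero _) (areaPow_ne_zero hJ s x)
    · filter_upwards [hu] with y hy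
      ext1 v
      rw [dbarOf_apply, LinearMap.zero_apply, hfun]
      refine smul_eq_zero_of_left ?_ _
      have hd (v : TangentSpace (𝓡 2) y) :
          mvfderiv (𝓡 2) f y v = -(Complex.exp (-u y) * mvfderiv (𝓡 2) u y v) := by
        have h1 := ((hasDerivAt_neg (u y)).cexp).hasFDerivAt.restrictScalars ℝ
        have h2 := mvfderiv_comp_eq_fderiv (φ := fun w : ℂ ↦ Complex.exp (-w))
          h1.differentiableAt (mdifferentiableAt_cFun u y) v
        rw [h1.fderiv] at h2
        refine h2.trans ?_
        simp [mul_comm]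
      rw [dbarCoeff, ← hy v, dbarFun, dbarFun, hd, hd]
      change _ + _ * Complex.exp (-u y) = 0
      ring

theorem holOf_bijective {s : ℝ} (hs : s ≠ 0) :
    Function.Bijective (holOf hJ s : OneForm M → HolStructure J s) := by
  refine ⟨fun θ θ' h ↦ dbarOf_injective hJ hs fun σ ↦ ?_, fun H ↦ ?_⟩
  · exact congrFun (congrArg HolStructure.dbar h) σ
  · obtain ⟨θ, hθ⟩ := H.exists_eq_dbarOf hJ hs
    exact ⟨θ, HolStructure.ext (funext fun σ ↦ (hθ σ).symm)⟩

end Holomorphic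

end WeylLine

end

/-! ### The bijection through 1-forms -/

theorem mainTheorem11 {M : Type*} [TopologicalSpace M] [T2Space M] [CompactSpace M]
    [ChartedSpace Plane M] [IsManifold (𝓡 2) ∞ M]
    (g : Metric M) (J : ComplexStr M)
    (hJ : ∀ (x : M) (v w : TangentSpace (𝓡 2) x),
      g.inner x (J.toFun x v) (J.toFun x w) = g.inner x v w)
    (m : ℕ) (hm : 2 ≤ m) :
    ∃ Φ : HolStructure J (((m : ℝ) - 1) / 2) ≃ ConformalConnection g,
      ∀ H : HolStructure J (((m : ℝ) - 1) / 2), IsZeroOnePart (Φ H).conn H := by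
  have hs : ((m : ℝ) - 1) / 2 ≠ 0 := by
    have : (2 : ℝ) ≤ m := by exact_mod_cast hm
    have : 0 < ((m : ℝ) - 1) / 2 := by linarith
    exact this.ne'
  let Ψ := Equiv.ofBijective _ (holOf_bijective hJ hs)
  refine ⟨Ψ.symm.trans (Equiv.ofBijective _ (weyl_bijective hJ)), fun H ↦ ?_⟩
  -- Once `H` is the structure of `θ`, its image is the Weyl connection of the same `θ`, and
  -- `connOf` is the induced connection on the line bundle.
  obtain ⟨θ, rfl⟩ := Ψ.surjective H
  rw [Equiv.trans_apply, Equiv.symm_apply_apply]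
  exact ⟨connOf hJ _ θ, isInducedConnection_connOf hJ _ (weylConn_nablaMetricEq hJ θ),
    fun σ x v ↦ dbarOf_eq_connOf hJ _ θ σ x v⟩
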